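/- **Setting.** Let $T>0$, let $(\Omega,\mathcal F,P)$ be a complete probability space with a right-continuous complete filtration $(\mathcal F_t)_{t\in[0,T]}$, and let $(\theta_k)_{k\ge 0}$ be stopping times with values in $[0,T]$, $\theta_0=0$, $\theta_k\le\theta_{k+1}$ a.s. and $\theta_k\to T$ a.s. All (in)equalities between random variables are meant a.s. Let $\Theta$ be the set of stopping times of the form $\tau=\sum_{k\ge0}\theta_k\mathbf 1_{A_k}+T\mathbf 1_{\bar A}$, where $((A_k)_k,\bar A)$ is a partition of $\Omega$, $A_k\in\mathcal F_{\theta_k}$, $\bar A\in\mathcal F_T$; for $S\in\Theta$ put $\Theta_S=\{\tau\in\Theta:\tau\ge S\}$. Fix $p\in[1,\infty]$. A family $\phi=(\phi(\tau))_{\tau\in\Theta}$ of real random variables is *admissible and $p$-integrable* if $\phi(\tau)\in L^p(\mathcal F_\tau)$ for all $\tau$ and $\phi(\tau)=\phi(\tau')$ on $\{\tau=\tau'\}$ for all $\tau,\tau'\in\Theta$. **Evaluations.** For $i=1,2$ let $\rho^i=(\rho^i_{S,\tau})_{S,\tau\in\Theta}$ satisfy (dropping $i$), for all $S,S',\tau\in\Theta$: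 (i) $\rho_{S,\tau}$ maps $L^p(\mathcal F_\tau)$ to $L^p(\mathcal F_S)$; (ii) $\rho_{S,\tau}[\eta]=\rho_{S',\tau}[\eta]$ on $\{S=S'\}$; (iii) $\rho_{\tau,S}[\eta]=\eta$ for $\eta\in L^p(\mathcal F_S)$, $\tau\in\Theta_S$; (iv) $\eta_1\le\eta_2$ implies $\rho_{S,\tau}[\eta_1]\le\rho_{S,\tau}[\eta_2]$; (v) $\rho_{S,\vartheta}[\rho_{\vartheta,\tau}[\eta]]=\rho_{S,\tau}[\eta]$ if $\vartheta\in\Theta$ and $S\le\vartheta\le\tau$; (vi) $\mathbf 1_A\rho_{S,\tau}[\xi(\tau)]=\mathbf 1_A\rho_{S,\tau'}[\xi(\tau')]$ for $A\in\mathcal F_S$, $\tau,\tau'\in\Theta_S$ with $\tau=\tau'$ on $A$, and every admissible $p$-integrable $\xi$; (vii) $\rho_{S,\tau}[\eta]\le\liminf_n\rho_{S,\tau}[\eta_n]$ if $\eta_n\in L^p(\mathcal F_\tau)$ is non-decreasing with a.s. limit $\eta\in L^p$; (viii) $\limsup_n\rho_{S,\tau_n}[\phi(\tau_n)]\le\rho_{S,\nu}[\limsup_n\phi(\tau_n)]$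 for every non-decreasing sequence $(\tau_n)$ in $\Theta_S$ with limit $\nu$ and every admissible $p$-integrable $\phi$ with $\sup_n|\phi(\tau_n)|\in L^p$; (ix) $\limsup_n\rho_{\theta_n,T}[\eta]\le\rho_{T,T}[\eta]$ for $\eta\in L^p(\mathcal F_T)$; and, in addition, the zero-one law $\mathbf 1_A\rho_{S,\tau}[\eta]=\mathbf 1_A\rho_{S,\tau}[\mathbf 1_A\eta]$ for $A\in\mathcal F_S$, $\tau\in\Theta_S$, $\eta\in L^p(\mathcal F_\tau)$, and the right-continuity property $\limsup_n\rho_{0,\nu_n}[\xi(\nu_n)]=\rho_{0,\nu}[\xi(\nu)]$ for all $\nu_n,\nu\in\Theta$ with $\nu_n\downarrow\nu$ and every admissible $p$-integrable $\xi$. **Pay-offs.** For $i=1,2$ let $X^i,Y^i$ be admissible $p$-integrable families such that (A1) $X^i(\tau)\le Y^i(\tau)$ for all $\tau\in\Theta$; (A2) $X^i(T)=Y^i(T)$; (A3) $\operatorname{ess\,sup}_{\tau\in\Theta}|X^i(\tau)|\in L^p$ and $\operatorname{ess\,sup}_{\tau\in\Theta}|Y^i(\tau)|\in L^p$; (A4)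 $\limsup_kX^i(\theta_k)\le X^i(T)$. Put $$J_1(\tau_1,\tau_2)=\rho^1_{0,\tau_1\wedge\tau_2}\big[X^1(\tau_1)\mathbf 1_{\{\tau_1\le\tau_2\}}+Y^1(\tau_2)\mathbf 1_{\{\tau_2<\tau_1\}}\big],\qquad J_2(\tau_1,\tau_2)=\rho^2_{0,\tau_1\wedge\tau_2}\big[X^2(\tau_2)\mathbf 1_{\{\tau_2<\tau_1\}}+Y^2(\tau_1)\mathbf 1_{\{\tau_1\le\tau_2\}}\big].$$ **Theorem.** There is a Nash equilibrium, that is, a pair $(\tau_1^*,\tau_2^*)\in\Theta\times\Theta$ with $J_1(\tau,\tau_2^*)\le J_1(\tau_1^*,\tau_2^*)$ and $J_2(\tau_1^*,\tau)\le J_2(\tau_1^*,\tau_2^*)$ a.s. for every $\tau\in\Theta$. Moreover it is obtained as follows. Put $\tau_1=\tau_2=T$ and, for $m\ge1$, with $i=1$ if $m$ is odd and $i=2$ if $m$ is even, $$\xi(\sigma)=X^i(\sigma)\mathbf 1_{\{\sigma<\tau_{m+1}\}}+Y^i(\tau_{m+1})\mathbf 1_{\{\tau_{m+1}\le\sigma\}},\quad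 V(S)=\operatorname*{ess\,sup}_{\sigma\in\Theta_S}\rho^i_{S,\sigma\wedge\tau_{m+1}}[\xi(\sigma)],\quad \tilde\tau=\operatorname{ess\,inf}\{\sigma\in\Theta:V(\sigma)=\xi(\sigma)\},$$ $$\tau_{m+2}=(\tilde\tau\wedge\tau_m)\mathbf 1_{\{\tilde\tau\wedge\tau_m<\tau_{m+1}\}}+\tau_m\mathbf 1_{\{\tilde\tau\wedge\tau_m\ge\tau_{m+1}\}}.$$ This recursion defines a sequence in $\Theta$; the limits $\tau_1^*=\lim_n\tau_{2n+1}$ and $\tau_2^*=\lim_n\tau_{2n}$ exist a.s. and belong to $\Theta$, and $(\tau_1^*,\tau_2^*)$ is a Nash equilibrium. -/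

import Mathlib

open MeasureTheory Filter Topology
open scoped ENNReal

/-- A finite horizon `T > 0`, a right-continuous complete filtration `(F t)` indexed by `[0, T]` on
the probability space `(Ω, P)`, and a sequence of stopping times `θ k` with `θ 0 = 0`, almost surely
non-decreasing in `k` and converging almost surely to `T`. -/
structure BermudanFramework {Ω : Type*} [mΩ : MeasurableSpace Ω] (P : Measure Ω) where
  T : ℝ
  T_pos : 0 < T
  F : Filtration (Set.Icc (0 : ℝ) T) mΩ
  rightContinuous : F.IsRightContinuous
  /-- Every `P`-null subset of `Ω` is in every `F t` (in particular, `P` is a complete measure). -/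
  complete : ∀ (t : Set.Icc (0 : ℝ) T) (N : Set Ω), P N = 0 → MeasurableSet[F t] N
  θ : ℕ → Ω → Set.Icc (0 : ℝ) T
  θ_stopping : ∀ k,
    IsStoppingTime F (fun ω => ((θ k ω : Set.Icc (0 : ℝ) T) : WithTop (Set.Icc (0 : ℝ) T)))
  θ_zero : ∀ᵐ ω ∂P, (θ 0 ω : ℝ) = 0
  θ_mono : ∀ k, ∀ᵐ ω ∂P, θ k ω ≤ θ (k + 1) ω
  θ_lim : ∀ᵐ ω ∂P, Tendsto (fun k => (θ k ω : ℝ)) atTop (𝓝 T)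

/-- `V` is the essential supremum of the family `𝒳`: the least measurable almost sure upper bound. -/
def IsEssSup {Ω α : Type*} [MeasurableSpace Ω] [MeasurableSpace α] [Preorder α] (P : Measure Ω)
    (𝒳 : Set (Ω → α)) (V : Ω → α) : Prop :=
  Measurable V ∧ (∀ g ∈ 𝒳, ∀ᵐ ω ∂P, g ω ≤ V ω) ∧
    ∀ h : Ω → α, Measurable h → (∀ g ∈ 𝒳, ∀ᵐ ω ∂P, g ω ≤ h ω) → ∀ᵐ ω ∂P, V ω ≤ h ω

/-- `V` is the essential infimum of the family `𝒳`: the greatest measurable almost sure lower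
bound. -/
def IsEssInf {Ω α : Type*} [MeasurableSpace Ω] [MeasurableSpace α] [Preorder α] (P : Measure Ω)
    (𝒳 : Set (Ω → α)) (V : Ω → α) : Prop :=
  Measurable V ∧ (∀ g ∈ 𝒳, ∀ᵐ ω ∂P, V ω ≤ g ω) ∧
    ∀ h : Ω → α, Measurable h → (∀ g ∈ 𝒳, ∀ᵐ ω ∂P, h ω ≤ g ω) → ∀ᵐ ω ∂P, h ω ≤ V ω

namespace BermudanFramework

section

variable {Ω : Type*} [mΩ : MeasurableSpace Ω] {P : Measure Ω} (𝓑 : BermudanFramework P)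

/-- The terminal time `T` as a point of `[0, T]`. -/
def horizon : Set.Icc (0 : ℝ) 𝓑.T := ⟨𝓑.T, 𝓑.T_pos.le, le_rfl⟩

/-- `τ` is a stopping time with values in `[0, T]`. -/
def IsStoppingIcc (τ : Ω → Set.Icc (0 : ℝ) 𝓑.T) : Prop :=
  IsStoppingTime 𝓑.F
    (fun ω => ((τ ω : Set.Icc (0 : ℝ) 𝓑.T) : WithTop (Set.Icc (0 : ℝ) 𝓑.T)))

/-- Bermudan stopping times: the stopping times `τ = ∑ₖ θ k 1_{A k} + T 1_{Ā}`, where the sets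
`A k ∈ F_{θ k}` and `Ā ∈ F_T` form a partition of `Ω`. -/
def IsBermudan (τ : Ω → Set.Icc (0 : ℝ) 𝓑.T) : Prop :=
  𝓑.IsStoppingIcc τ ∧ ∃ (A : ℕ → Set Ω) (Abar : Set Ω),
    (∀ k, MeasurableSet[(𝓑.θ_stopping k).measurableSpace] (A k)) ∧
    MeasurableSet[𝓑.F 𝓑.horizon] Abar ∧
    (∀ j k, j ≠ k → Disjoint (A j) (A k)) ∧ (∀ k, Disjoint (A k) Abar) ∧
    (⋃ k, A k) ∪ Abar = Set.univ ∧
    ∀ᵐ ω ∂P, (∀ k, ω ∈ A k → τ ω = 𝓑.θ k ω) ∧ (ω ∈ Abar → τ ω = 𝓑.horizon)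

theorem measurableSet_horizon {τ : Ω → Set.Icc (0 : ℝ) 𝓑.T} (hτ : 𝓑.IsStoppingIcc τ) {A : Set Ω}
    (hA : MeasurableSet[IsStoppingTime.measurableSpace hτ] A) :
    MeasurableSet[𝓑.F 𝓑.horizon] A := by
  have h := hA.2 𝓑.horizon
  have h2 : {ω | ((τ ω : Set.Icc (0 : ℝ) 𝓑.T) : WithTop (Set.Icc (0 : ℝ) 𝓑.T)) ≤ 𝓑.horizon}
      = Set.univ := by
    ext ω
    simp only [Set.mem_ofPred_eq, Set.mem_univ, iff_true]
    exact WithTop.coe_le_coe.2 (τ ω).2.2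
  rwa [h2, Set.inter_univ] at h

theorem isBermudan_iff (τ : Ω → Set.Icc (0 : ℝ) 𝓑.T) :
    𝓑.IsBermudan τ ↔
      𝓑.IsStoppingIcc τ ∧ ∀ᵐ ω ∂P, τ ω = 𝓑.horizon ∨ ∃ k, τ ω = 𝓑.θ k ω := by
  constructor
  · rintro ⟨hs, A, Abar, -, -, -, -, hcov, hτ⟩
    refine ⟨hs, hτ.mono fun ω hω => ?_⟩
    have : ω ∈ (⋃ k, A k) ∪ Abar := hcov ▸ Set.mem_univ ω
    rcases this with h | h
    · obtain ⟨k, hk⟩ := Set.mem_iUnion.1 h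
      exact Or.inr ⟨k, hω.1 k hk⟩
    · exact Or.inl (hω.2 h)
  · rintro ⟨hs, hτ⟩
    let A : ℕ → Set Ω := fun k =>
      {ω | 𝓑.θ k ω = τ ω} ∩ ⋂ j : Fin k, {ω | 𝓑.θ k ω = 𝓑.θ j ω}ᶜ
    have hA : ∀ k, MeasurableSet[(𝓑.θ_stopping k).measurableSpace] (A k) := by
      intro k
      have h1 : ∀ σ : Ω → Set.Icc (0 : ℝ) 𝓑.T, 𝓑.IsStoppingIcc σ →
          MeasurableSet[(𝓑.θ_stopping k).measurableSpace] {ω | 𝓑.θ k ω = σ ω} := by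
        intro σ hσ
        have := IsStoppingTime.measurableSet_eq_stopping_time (𝓑.θ_stopping k) hσ
        simpa only [WithTop.coe_inj] using this
      exact MeasurableSet.inter (h1 τ hs)
        (MeasurableSet.iInter fun j => (h1 _ (𝓑.θ_stopping j)).compl)
    refine ⟨hs, A, (⋃ k, A k)ᶜ, hA, ?_, ?_, ?_, Set.union_compl_self _, ?_⟩
    · exact (MeasurableSet.iUnion fun k =>
        𝓑.measurableSet_horizon (𝓑.θ_stopping k) (hA k)).compl
    · have key : ∀ j k, j < k → Disjoint (A j) (A k) := by
        intro j k hjk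
        refine Set.disjoint_left.2 fun ω hj hk => ?_
        have := Set.mem_iInter.1 hk.2 ⟨j, hjk⟩
        exact this (hk.1.trans hj.1.symm)
      intro j k hjk
      rcases lt_or_gt_of_ne hjk with h | h
      · exact key j k h
      · exact (key k j h).symm
    · exact fun k => Set.disjoint_left.2 fun ω h1 h2 => h2 (Set.mem_iUnion.2 ⟨k, h1⟩)
    · refine hτ.mono fun ω hω => ⟨fun k hk => hk.1.symm, fun hbar => ?_⟩
      rcases hω with h | h
      · exact h
      · exfalso
        classical
        refine hbar (Set.mem_iUnion.2 ⟨Nat.find h, (Nat.find_spec h).symm, ?_⟩)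
        refine Set.mem_iInter.2 fun j hj => Nat.find_min h j.2 ?_
        exact (Nat.find_spec h).trans hj

/-- The set `Θ` of Bermudan stopping strategies. -/
def Strategy : Type _ := {τ : Ω → Set.Icc (0 : ℝ) 𝓑.T // 𝓑.IsBermudan τ}

/-- The stopping time `θ k` as a strategy. -/
def theta (k : ℕ) : 𝓑.Strategy :=
  ⟨𝓑.θ k, (𝓑.isBermudan_iff _).2 ⟨𝓑.θ_stopping k, ae_of_all _ fun _ => Or.inr ⟨k, rfl⟩⟩⟩

/-- The constant time `T` as a strategy. -/
def terminal : 𝓑.Strategy :=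
  ⟨fun _ => 𝓑.horizon,
    (𝓑.isBermudan_iff _).2 ⟨isStoppingTime_const 𝓑.F _, ae_of_all _ fun _ => Or.inl rfl⟩⟩

variable {𝓑}

/-- The minimum `τ ∧ σ` of two strategies. -/
def Strategy.inf (τ σ : 𝓑.Strategy) : 𝓑.Strategy :=
  ⟨fun ω => min (τ.1 ω) (σ.1 ω), (𝓑.isBermudan_iff _).2 ⟨by
      have h := IsStoppingTime.min τ.2.1 σ.2.1
      intro t
      simpa only [WithTop.coe_min] using h t, by
      filter_upwards [((𝓑.isBermudan_iff _).1 τ.2).2, ((𝓑.isBermudan_iff _).1 σ.2).2] with ω h1 h2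
      rcases min_choice (τ.1 ω) (σ.1 ω) with h | h
      · rw [h]; exact h1
      · rw [h]; exact h2⟩⟩

/-- The σ-algebra `F_τ`. -/
@[reducible] def Strategy.sigma (τ : 𝓑.Strategy) : MeasurableSpace Ω :=
  IsStoppingTime.measurableSpace τ.2.1

/-- `S ≤ τ` almost surely, i.e. `τ ∈ Θ_S`. -/
def Strategy.LE (S τ : 𝓑.Strategy) : Prop := ∀ᵐ ω ∂P, S.1 ω ≤ τ.1 ω

/-- `η ∈ L^p(F_τ)`. -/
def Strategy.InLp (p : ℝ≥0∞) (τ : 𝓑.Strategy) (η : Ω → ℝ) : Prop :=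
  Measurable[τ.sigma] η ∧ MemLp η p P

variable (𝓑)

/-- Families of random variables indexed by `Θ`. -/
abbrev Family : Type _ := 𝓑.Strategy → Ω → ℝ

/-- Families of operators `ρ_{S, τ}[η]`. Only the values at `η ∈ L^p(F_τ)` are ever relevant. -/
abbrev Operators : Type _ := 𝓑.Strategy → 𝓑.Strategy → (Ω → ℝ) → (Ω → ℝ)

variable {𝓑}

/-- Admissible `p`-integrable families. -/
structure IsAdmissible (p : ℝ≥0∞) (φ : 𝓑.Family) : Prop where
  measurable : ∀ τ : 𝓑.Strategy, Measurable[τ.sigma] (φ τ)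
  congr : ∀ τ τ' : 𝓑.Strategy, ∀ᵐ ω ∂P, τ.1 ω = τ'.1 ω → φ τ ω = φ τ' ω
  memLp : ∀ τ : 𝓑.Strategy, MemLp (φ τ) p P

/-- The standing properties of a non-linear evaluation `ρ`. Limits inferior and superior of
sequences of real random variables are taken in the extended reals. -/
structure IsEvaluation (p : ℝ≥0∞) (ρ : 𝓑.Operators) : Prop where
  /-- `ρ_{S, τ}` maps `L^p(F_τ)` to `L^p(F_S)`. -/
  maps : ∀ (S τ : 𝓑.Strategy) (η : Ω → ℝ), τ.InLp p η → S.InLp p (ρ S τ η)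
  admissibility : ∀ (S S' τ : 𝓑.Strategy) (η : Ω → ℝ), τ.InLp p η →
    ∀ᵐ ω ∂P, S.1 ω = S'.1 ω → ρ S τ η ω = ρ S' τ η ω
  knowledge_preservation : ∀ (S τ : 𝓑.Strategy) (η : Ω → ℝ), S.InLp p η → S.LE τ →
    ∀ᵐ ω ∂P, ρ τ S η ω = η ω
  monotonicity : ∀ (S τ : 𝓑.Strategy) (η₁ η₂ : Ω → ℝ), τ.InLp p η₁ → τ.InLp p η₂ →
    (∀ᵐ ω ∂P, η₁ ω ≤ η₂ ω) → ∀ᵐ ω ∂P, ρ S τ η₁ ω ≤ ρ S τ η₂ ω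
  consistency : ∀ (S ϑ τ : 𝓑.Strategy) (η : Ω → ℝ), τ.InLp p η → S.LE ϑ → ϑ.LE τ →
    ∀ᵐ ω ∂P, ρ S ϑ (ρ ϑ τ η) ω = ρ S τ η ω
  generalized_zero_one : ∀ (ξ : 𝓑.Family), IsAdmissible p ξ →
    ∀ (S τ τ' : 𝓑.Strategy) (A : Set Ω), MeasurableSet[S.sigma] A → S.LE τ → S.LE τ' →
    (∀ᵐ ω ∂P, ω ∈ A → τ.1 ω = τ'.1 ω) →
    ∀ᵐ ω ∂P, ω ∈ A → ρ S τ (ξ τ) ω = ρ S τ' (ξ τ') ω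
  monotone_fatou : ∀ (S τ : 𝓑.Strategy) (η : ℕ → Ω → ℝ) (η' : Ω → ℝ),
    (∀ n, τ.InLp p (η n)) → τ.InLp p η' → (∀ᵐ ω ∂P, Monotone fun n => η n ω) →
    (∀ᵐ ω ∂P, Tendsto (fun n => η n ω) atTop (𝓝 (η' ω))) →
    ∀ᵐ ω ∂P, (ρ S τ η' ω : EReal) ≤ liminf (fun n => (ρ S τ (η n) ω : EReal)) atTop
  /-- Left-upper-semicontinuity along Bermudan stopping times; `η` is the random variable
  `limsup φ(τ n)`. -/
  lusc : ∀ (φ : 𝓑.Family), IsAdmissible p φ →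
    ∀ (S ν : 𝓑.Strategy) (τ : ℕ → 𝓑.Strategy), (∀ n, S.LE (τ n)) →
    (∀ᵐ ω ∂P, Monotone fun n => (τ n).1 ω) →
    (∀ᵐ ω ∂P, Tendsto (fun n => (τ n).1 ω) atTop (𝓝 (ν.1 ω))) →
    (∃ Z : Ω → ℝ, MemLp Z p P ∧ ∀ n, ∀ᵐ ω ∂P, |φ (τ n) ω| ≤ Z ω) →
    ∀ η : Ω → ℝ, ν.InLp p η →
    (∀ᵐ ω ∂P, (η ω : EReal) = limsup (fun n => (φ (τ n) ω : EReal)) atTop) →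
    ∀ᵐ ω ∂P, limsup (fun n => (ρ S (τ n) (φ (τ n)) ω : EReal)) atTop ≤ (ρ S ν η ω : EReal)
  limsup_terminal : ∀ η : Ω → ℝ, 𝓑.terminal.InLp p η →
    ∀ᵐ ω ∂P, limsup (fun n => (ρ (𝓑.theta n) 𝓑.terminal η ω : EReal)) atTop ≤
      (ρ 𝓑.terminal 𝓑.terminal η ω : EReal)

/-- The usual zero-one law: `1_A ρ_{S, τ}[η] = 1_A ρ_{S, τ}[1_A η]` for `A ∈ F_S` and
`τ ∈ Θ_S`. -/
def ZeroOneLaw (p : ℝ≥0∞) (ρ : 𝓑.Operators) : Prop :=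
  ∀ (S τ : 𝓑.Strategy) (A : Set Ω) (η : Ω → ℝ), S.LE τ → MeasurableSet[S.sigma] A → τ.InLp p η →
    ∀ᵐ ω ∂P, ω ∈ A → ρ S τ η ω = ρ S τ (A.indicator η) ω

/-- `limsup ρ_{0, ν n}[ξ(ν n)] = ρ_{0, ν}[ξ(ν)]` whenever `ν n` decreases to `ν` and `ξ` is an
admissible `p`-integrable family (time `0` is the strategy `θ 0`). -/
def RightContinuity (p : ℝ≥0∞) (ρ : 𝓑.Operators) : Prop :=
  ∀ (ξ : 𝓑.Family), IsAdmissible p ξ → ∀ (ν : ℕ → 𝓑.Strategy) (ν' : 𝓑.Strategy),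
    (∀ᵐ ω ∂P, Antitone fun n => (ν n).1 ω) →
    (∀ᵐ ω ∂P, Tendsto (fun n => (ν n).1 ω) atTop (𝓝 (ν'.1 ω))) →
    ∀ᵐ ω ∂P, limsup (fun n => (ρ (𝓑.theta 0) (ν n) (ξ (ν n)) ω : EReal)) atTop =
      (ρ (𝓑.theta 0) ν' (ξ ν') ω : EReal)

/-- `ess sup_{τ ∈ Θ} |φ(τ)|` belongs to `L^p`. -/
def EssSupInLp (p : ℝ≥0∞) (φ : 𝓑.Family) : Prop :=
  ∃ Z : Ω → ℝ, IsEssSup P {g | ∃ τ : 𝓑.Strategy, g = fun ω => |φ τ ω|} Z ∧ MemLp Z p P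

/-- The assumptions on the pay-off families `X ≤ Y` of one agent. -/
structure IsPayoff (p : ℝ≥0∞) (X Y : 𝓑.Family) : Prop where
  admissible_X : IsAdmissible p X
  admissible_Y : IsAdmissible p Y
  le : ∀ τ : 𝓑.Strategy, ∀ᵐ ω ∂P, X τ ω ≤ Y τ ω
  terminal_eq : ∀ᵐ ω ∂P, X 𝓑.terminal ω = Y 𝓑.terminal ω
  essSup_X : EssSupInLp p X
  essSup_Y : EssSupInLp p Y
  limsup_le : ∀ᵐ ω ∂P,
    limsup (fun k => (X (𝓑.theta k) ω : EReal)) atTop ≤ (X 𝓑.terminal ω : EReal)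

/-- Pay-off of agent 1: `X(τ₁) 1_{τ₁ ≤ τ₂} + Y(τ₂) 1_{τ₂ < τ₁}`. -/
noncomputable def payoff₁ (X Y : 𝓑.Family) (τ₁ τ₂ : 𝓑.Strategy) : Ω → ℝ :=
  fun ω => if τ₁.1 ω ≤ τ₂.1 ω then X τ₁ ω else Y τ₂ ω

/-- Pay-off of agent 2: `X(τ₂) 1_{τ₂ < τ₁} + Y(τ₁) 1_{τ₁ ≤ τ₂}`. -/
noncomputable def payoff₂ (X Y : 𝓑.Family) (τ₁ τ₂ : 𝓑.Strategy) : Ω → ℝ :=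
  fun ω => if τ₂.1 ω < τ₁.1 ω then X τ₂ ω else Y τ₁ ω

/-- Assessment of agent 1 at time `0`. -/
noncomputable def J₁ (ρ : 𝓑.Operators) (X Y : 𝓑.Family) (τ₁ τ₂ : 𝓑.Strategy) : Ω → ℝ :=
  ρ (𝓑.theta 0) (τ₁.inf τ₂) (payoff₁ X Y τ₁ τ₂)

/-- Assessment of agent 2 at time `0`. -/
noncomputable def J₂ (ρ : 𝓑.Operators) (X Y : 𝓑.Family) (τ₁ τ₂ : 𝓑.Strategy) : Ω → ℝ :=
  ρ (𝓑.theta 0) (τ₁.inf τ₂) (payoff₂ X Y τ₁ τ₂)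

/-- `(τ₁, τ₂)` is a Nash equilibrium of the game. -/
def IsNash (ρ₁ ρ₂ : 𝓑.Operators) (X₁ Y₁ X₂ Y₂ : 𝓑.Family) (τ₁ τ₂ : 𝓑.Strategy) : Prop :=
  (∀ σ : 𝓑.Strategy, ∀ᵐ ω ∂P, J₁ ρ₁ X₁ Y₁ σ τ₂ ω ≤ J₁ ρ₁ X₁ Y₁ τ₁ τ₂ ω) ∧
  (∀ σ : 𝓑.Strategy, ∀ᵐ ω ∂P, J₂ ρ₂ X₂ Y₂ τ₁ σ ω ≤ J₂ ρ₂ X₂ Y₂ τ₁ τ₂ ω)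

/-- The pay-off `ξ(σ) = X(σ) 1_{σ < β} + Y(β) 1_{β ≤ σ}` of an agent who plays `σ` against the
strategy `β` of the opponent. -/
noncomputable def stoppingPayoff (X Y : 𝓑.Family) (β : 𝓑.Strategy) : 𝓑.Family :=
  fun σ ω => if σ.1 ω < β.1 ω then X σ ω else Y β ω

/-- `V(S) = ess sup_{σ ∈ Θ_S} ρ_{S, σ ∧ β}[ξ(σ)]` for every `S ∈ Θ`. -/
def IsValueFamily (ρ : 𝓑.Operators) (ξ : 𝓑.Family) (β : 𝓑.Strategy)
    (V : 𝓑.Strategy → Ω → EReal) : Prop :=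
  ∀ S : 𝓑.Strategy, IsEssSup P
    {g | ∃ σ : 𝓑.Strategy, S.LE σ ∧ g = fun ω => (ρ S (σ.inf β) (ξ σ) ω : EReal)} (V S)

/-- `τ` is the next strategy of an agent whose previous strategy is `α`, against the strategy `β` of
the opponent: with `t = ess inf {σ ∈ Θ : V(σ) = ξ(σ)}`,
`τ = (t ∧ α) 1_{t ∧ α < β} + α 1_{t ∧ α ≥ β}`. -/
def IsBestResponseStep (ρ : 𝓑.Operators) (X Y : 𝓑.Family) (β α τ : 𝓑.Strategy) : Prop :=
  ∃ (V : 𝓑.Strategy → Ω → EReal) (t : Ω → Set.Icc (0 : ℝ) 𝓑.T),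
    IsValueFamily ρ (stoppingPayoff X Y β) β V ∧
    IsEssInf P {g | ∃ σ : 𝓑.Strategy,
      (∀ᵐ ω ∂P, V σ ω = (stoppingPayoff X Y β σ ω : EReal)) ∧ g = σ.1} t ∧
    ∀ᵐ ω ∂P, τ.1 ω =
      if min (t ω) (α.1 ω) < β.1 ω then min (t ω) (α.1 ω) else α.1 ω

/-- The recursive best-response sequence: `τ 1 = τ 2 = T`, then the agents update in turn, agent 1
at the odd indices and agent 2 at the even ones (`τ 0` plays no role). -/
def IsBestResponseSequence (ρ₁ ρ₂ : 𝓑.Operators) (X₁ Y₁ X₂ Y₂ : 𝓑.Family)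
    (τ : ℕ → 𝓑.Strategy) : Prop :=
  (∀ᵐ ω ∂P, (τ 1).1 ω = 𝓑.horizon) ∧ (∀ᵐ ω ∂P, (τ 2).1 ω = 𝓑.horizon) ∧
  ∀ n : ℕ,
    IsBestResponseStep ρ₁ X₁ Y₁ (τ (2 * n + 2)) (τ (2 * n + 1)) (τ (2 * n + 3)) ∧
    IsBestResponseStep ρ₂ X₂ Y₂ (τ (2 * n + 3)) (τ (2 * n + 2)) (τ (2 * n + 4))

end

end BermudanFramework

namespace BermudanFramework

/-! ### The lattice of strategies: σ-algebras, pasting, stationary limits -/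

section StrategyAlgebra

variable {Ω : Type*} [mΩ : MeasurableSpace Ω] {P : Measure Ω} {𝓑 : BermudanFramework P}

/-! Against a fixed opponent strategy `β`, an agent faces an optimal stopping problem with reward `ξ
= stoppingPayoff X Y β`. The first contact of the value with `ξ` is a best response
(`assess_le_firstContact`). At a contact, continuing is worth at most `ξ`, so stopping there loses
nothing. Before the first contact the value exceeds `ξ` strictly, and pasting competitors that beat
`ξ` yields a strictly later strategy that is no worse (`exists_improvement`). Iterating, each path
either reaches the target or runs through a subsequence of the grid `θ` up to `T`;
left-upper-semicontinuity and (A4) then conclude (`le_of_improvement`).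

In the alternating recursion an agent either moves strictly before the opponent's current strategy
or does not move at all. Hence, if `α` was a best response and the opponent then moved to `β`,
nothing has changed on `{α < β}`: by the zero-one law the value at `α` is the same there, and `α` is
still in contact (`IsBestResponse.essInf_le`). So capping the new first contact by `α` does no harm,
and every term from `τ 3` on is a best response to its predecessor. Each agent's strategies
decrease. As the grid is non-decreasing, a non-increasing sequence in grid ∪ {T} is stationary path
by path (`Strategy.exists_limit`), so the limits are attained and are strategies.

Right-continuity concerns one admissible family along a decreasing sequence of times, whereas the
pay-offs depend on pairs of strategies. The order structure reconciles the two: ties occur only at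
`T` (`Update.eq_top_of_eq`), and a value of the minimum is always attained by the same agent
(`Update.not_clash`). All pay-offs along the recursion are therefore values of a single family at
the minimum of the two strategies, and optimality passes to the limit (`assess_le_of_limit`). The
different tie rule in `J₁` is harmless because `X ≤ Y`, with equality at `T`. -/

theorem Strategy.measurableSet_sigma_iff (τ : 𝓑.Strategy) (A : Set Ω) :
    MeasurableSet[τ.sigma] A ↔ ∀ t, MeasurableSet[𝓑.F t] (A ∩ {ω | τ.1 ω ≤ t}) := by
  have h : MeasurableSet[τ.sigma] A ↔ MeasurableSet[⨆ t, 𝓑.F t] A ∧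
      ∀ t, MeasurableSet[𝓑.F t] (A ∩ {ω | τ.1 ω ≤ t}) := by
    have h := IsStoppingTime.measurableSet τ.2.1 A
    simpa only [WithTop.coe_le_coe] using h
  refine h.trans ⟨fun h => h.2, fun h => ⟨?_, h⟩⟩
  have h1 := h 𝓑.horizon
  have h2 : {ω | τ.1 ω ≤ 𝓑.horizon} = Set.univ :=
    Set.eq_univ_of_forall fun ω => (τ.1 ω).2.2
  rw [h2, Set.inter_univ] at h1
  exact le_iSup (fun t => (𝓑.F t : MeasurableSpace Ω)) 𝓑.horizon _ h1

theorem Strategy.sigma_le (τ : 𝓑.Strategy) : τ.sigma ≤ mΩ :=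
  IsStoppingTime.measurableSpace_le τ.2.1

theorem Strategy.measurableSet_le_const (τ : 𝓑.Strategy) (t : Set.Icc (0 : ℝ) 𝓑.T) :
    MeasurableSet[𝓑.F t] {ω | τ.1 ω ≤ t} := by
  have h := τ.2.1 t
  simpa only [WithTop.coe_le_coe] using h

theorem Strategy.measurableSet_of_null (τ : 𝓑.Strategy) {N : Set Ω} (hN : P N = 0) :
    MeasurableSet[τ.sigma] N :=
  (τ.measurableSet_sigma_iff N).2 fun t =>
    𝓑.complete t _ (measure_mono_null Set.inter_subset_left hN)

/-- In a σ-algebra containing the null sets, measurability is invariant under a.e. equality. -/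
theorem measurableSet_congr_ae_of_null {m : MeasurableSpace Ω}
    (hm : ∀ N, P N = 0 → MeasurableSet[m] N) {A B : Set Ω} (hA : MeasurableSet[m] A)
    (h : ∀ᵐ ω ∂P, ω ∈ A ↔ ω ∈ B) : MeasurableSet[m] B := by
  have hN := hm _ (ae_iff.1 h)
  have h1 : ∀ C ⊆ {ω | ¬(ω ∈ A ↔ ω ∈ B)}, MeasurableSet[m] C := fun C hC =>
    hm _ (measure_mono_null hC (ae_iff.1 h))
  have : B = (A \ (A \ B)) ∪ (B \ A) := by
    ext ω; simp only [Set.mem_union, Set.mem_sdiff]; tauto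
  rw [this]
  refine MeasurableSet.union (MeasurableSet.diff hA (h1 _ ?_)) (h1 _ ?_)
  · rintro ω ⟨h1, h2⟩; simp [h1, h2]
  · rintro ω ⟨h1, h2⟩; simp [h1, h2]

theorem Strategy.measurableSet_congr_ae (τ : 𝓑.Strategy) {A B : Set Ω}
    (hA : MeasurableSet[τ.sigma] A) (h : ∀ᵐ ω ∂P, ω ∈ A ↔ ω ∈ B) : MeasurableSet[τ.sigma] B :=
  measurableSet_congr_ae_of_null (fun _ => τ.measurableSet_of_null) hA h

theorem Strategy.measurable_congr_ae {α : Type*} [MeasurableSpace α] (τ : 𝓑.Strategy)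
    {f g : Ω → α} (hf : Measurable[τ.sigma] f) (h : ∀ᵐ ω ∂P, f ω = g ω) :
    Measurable[τ.sigma] g := fun s hs =>
  τ.measurableSet_congr_ae (hf hs) (h.mono fun ω hω => by simp [hω])

/-- The order between strategies holds only almost surely; completeness of each `F t` absorbs the
exceptional null set. -/
theorem Strategy.sigma_mono {S τ : 𝓑.Strategy} (h : S.LE τ) : S.sigma ≤ τ.sigma := by
  intro A hA
  rw [Strategy.measurableSet_sigma_iff] at hA ⊢
  intro t
  refine measurableSet_congr_ae_of_null (𝓑.complete t)
    ((hA t).inter (τ.measurableSet_le_const t)) (h.mono fun ω hω => ?_)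
  simp only [Set.mem_inter_iff, Set.mem_ofPred_eq]
  exact ⟨fun h => ⟨h.1.1, h.2⟩, fun h => ⟨⟨h.1, hω.trans h.2⟩, h.2⟩⟩

theorem Strategy.LE.refl (τ : 𝓑.Strategy) : τ.LE τ := ae_of_all _ fun _ => le_rfl

theorem Strategy.LE.trans {ρ σ τ : 𝓑.Strategy} (h : ρ.LE σ) (h' : σ.LE τ) : ρ.LE τ := by
  filter_upwards [h, h'] with ω h1 h2 using h1.trans h2

theorem Strategy.inf_le_left (σ τ : 𝓑.Strategy) : (σ.inf τ).LE σ :=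
  ae_of_all _ fun _ => min_le_left _ _

theorem Strategy.inf_le_right (σ τ : 𝓑.Strategy) : (σ.inf τ).LE τ :=
  ae_of_all _ fun _ => min_le_right _ _

theorem Strategy.le_inf {ρ σ τ : 𝓑.Strategy} (h : ρ.LE σ) (h' : ρ.LE τ) : ρ.LE (σ.inf τ) := by
  filter_upwards [h, h'] with ω h1 h2 using _root_.le_min h1 h2

theorem Strategy.le_terminal (τ : 𝓑.Strategy) : τ.LE 𝓑.terminal :=
  ae_of_all _ fun ω => (τ.1 ω).2.2

theorem Strategy.theta_zero_le (τ : 𝓑.Strategy) : (𝓑.theta 0).LE τ := by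
  filter_upwards [𝓑.θ_zero] with ω h
  exact Subtype.coe_le_coe.1 (h.le.trans (τ.1 ω).2.1)

@[simp] theorem Strategy.inf_val (σ τ : 𝓑.Strategy) (ω : Ω) :
    (σ.inf τ).1 ω = min (σ.1 ω) (τ.1 ω) := rfl

@[simp] theorem terminal_val (ω : Ω) : (𝓑.terminal).1 ω = 𝓑.horizon := rfl

theorem Strategy.inf_comm (σ τ : 𝓑.Strategy) : σ.inf τ = τ.inf σ :=
  Subtype.ext (funext fun _ => min_comm _ _)

theorem le_horizon (x : Set.Icc (0 : ℝ) 𝓑.T) : x ≤ 𝓑.horizon := x.2.2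

theorem Strategy.measurableSet_inf_iff (σ τ : 𝓑.Strategy) (A : Set Ω) :
    MeasurableSet[(σ.inf τ).sigma] A ↔ MeasurableSet[σ.sigma] A ∧ MeasurableSet[τ.sigma] A := by
  refine ⟨fun h => ⟨sigma_mono (inf_le_left σ τ) _ h, sigma_mono (inf_le_right σ τ) _ h⟩,
    fun ⟨h1, h2⟩ => ?_⟩
  rw [Strategy.measurableSet_sigma_iff] at h1 h2 ⊢
  intro t
  have : A ∩ {ω | (σ.inf τ).1 ω ≤ t} = (A ∩ {ω | σ.1 ω ≤ t}) ∪ (A ∩ {ω | τ.1 ω ≤ t}) := by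
    ext ω; simp only [Set.mem_inter_iff, Set.mem_union, Set.mem_ofPred_eq, inf_val, min_le_iff]
    tauto
  rw [this]
  exact (h1 t).union (h2 t)

theorem Strategy.measurableSet_le_left (σ τ : 𝓑.Strategy) :
    MeasurableSet[σ.sigma] {ω | σ.1 ω ≤ τ.1 ω} := by
  have := IsStoppingTime.measurableSet_le_stopping_time σ.2.1 τ.2.1
  simpa only [WithTop.coe_le_coe] using this

theorem Strategy.measurableSet_le_right (σ τ : 𝓑.Strategy) :
    MeasurableSet[τ.sigma] {ω | σ.1 ω ≤ τ.1 ω} := by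
  have := IsStoppingTime.measurableSet_stopping_time_le σ.2.1 τ.2.1
  simpa only [WithTop.coe_le_coe] using this

theorem Strategy.measurableSet_lt_left (σ τ : 𝓑.Strategy) :
    MeasurableSet[σ.sigma] {ω | σ.1 ω < τ.1 ω} := by
  convert (τ.measurableSet_le_right σ).compl using 1
  ext ω; simp

theorem Strategy.measurableSet_lt_right (σ τ : 𝓑.Strategy) :
    MeasurableSet[τ.sigma] {ω | σ.1 ω < τ.1 ω} := by
  convert (τ.measurableSet_le_left σ).compl using 1
  ext ω; simp

theorem Strategy.measurableSet_eq (σ τ : 𝓑.Strategy) :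
    MeasurableSet[σ.sigma] {ω | σ.1 ω = τ.1 ω} := by
  convert (σ.measurableSet_le_left τ).inter (τ.measurableSet_le_right σ) using 1
  ext ω; simp [le_antisymm_iff]

theorem Strategy.measurableSet_inter_le {σ : 𝓑.Strategy} (τ : 𝓑.Strategy) {A : Set Ω}
    (hA : MeasurableSet[σ.sigma] A) :
    MeasurableSet[τ.sigma] (A ∩ {ω | σ.1 ω ≤ τ.1 ω}) := by
  have h1 := IsStoppingTime.measurableSet_inter_le σ.2.1 τ.2.1 A hA
  have h2 := (IsStoppingTime.measurableSet_min_iff σ.2.1 τ.2.1 _).1 h1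
  simpa only [WithTop.coe_le_coe] using h2.2

theorem Strategy.measurableSet_inter_lt {σ : 𝓑.Strategy} (τ : 𝓑.Strategy) {A : Set Ω}
    (hA : MeasurableSet[σ.sigma] A) :
    MeasurableSet[τ.sigma] (A ∩ {ω | σ.1 ω < τ.1 ω}) := by
  convert (measurableSet_inter_le τ hA).inter (σ.measurableSet_lt_right τ) using 1
  ext ω
  simp only [Set.mem_inter_iff, Set.mem_ofPred_eq]
  exact ⟨fun h => ⟨⟨h.1, h.2.le⟩, h.2⟩, fun h => ⟨h.1.1, h.2⟩⟩

/-- The strategy playing `σ k` on `{n = k}`. -/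
def Strategy.pasteSeq (σ : ℕ → 𝓑.Strategy) (n : Ω → ℕ)
    (hn : ∀ k, MeasurableSet[(σ k).sigma] {ω | n ω = k}) : 𝓑.Strategy :=
  ⟨fun ω => (σ (n ω)).1 ω, (𝓑.isBermudan_iff _).2 ⟨by
      intro t
      have h : {ω | (((σ (n ω)).1 ω : Set.Icc (0 : ℝ) 𝓑.T) : WithTop (Set.Icc (0 : ℝ) 𝓑.T)) ≤ t}
          = ⋃ k, {ω | n ω = k} ∩ {ω | (σ k).1 ω ≤ t} := by
        ext ω
        simp
      rw [h]
      exact MeasurableSet.iUnion fun k => ((σ k).measurableSet_sigma_iff _).1 (hn k) t, by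
      have h : ∀ᵐ ω ∂P, ∀ k, (σ k).1 ω = 𝓑.horizon ∨ ∃ j, (σ k).1 ω = 𝓑.θ j ω :=
        ae_all_iff.2 fun k => ((𝓑.isBermudan_iff _).1 (σ k).2).2
      exact h.mono fun ω hω => hω _⟩⟩

open Classical in
/-- The strategy playing `σ` on `A` and `τ` on the complement of `A`. -/
noncomputable def Strategy.paste (A : Set Ω) (σ τ : 𝓑.Strategy) (hσ : MeasurableSet[σ.sigma] A)
    (hτ : MeasurableSet[τ.sigma] A) : 𝓑.Strategy :=
  Strategy.pasteSeq (fun k => if k = 0 then σ else τ) (fun ω => if ω ∈ A then 0 else 1) (by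
    intro k
    by_cases hk : k = 0
    · subst hk; simpa using hσ
    · by_cases hk' : k = 1
      · subst hk'
        have : {ω | (if ω ∈ A then 0 else 1) = 1} = Aᶜ := by ext ω; simp
        rw [this, if_neg hk]; exact hτ.compl
      · have : {ω | (if ω ∈ A then 0 else 1) = k} = ∅ := by
          ext ω; by_cases h : ω ∈ A <;> simp [h, Ne.symm hk, Ne.symm hk']
        rw [this]
        exact @MeasurableSet.empty _ (_))

theorem Strategy.paste_of_mem {A : Set Ω} {σ τ : 𝓑.Strategy} (hσ : MeasurableSet[σ.sigma] A)
    (hτ : MeasurableSet[τ.sigma] A) {ω : Ω} (h : ω ∈ A) : (paste A σ τ hσ hτ).1 ω = σ.1 ω := by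
  simp [paste, pasteSeq, h]

theorem Strategy.paste_of_notMem {A : Set Ω} {σ τ : 𝓑.Strategy} (hσ : MeasurableSet[σ.sigma] A)
    (hτ : MeasurableSet[τ.sigma] A) {ω : Ω} (h : ω ∉ A) : (paste A σ τ hσ hτ).1 ω = τ.1 ω := by
  simp [paste, pasteSeq, h]

theorem Strategy.ae_mem_grid (τ : 𝓑.Strategy) :
    ∀ᵐ ω ∂P, τ.1 ω = 𝓑.horizon ∨ ∃ k, τ.1 ω = 𝓑.θ k ω :=
  ((𝓑.isBermudan_iff _).1 τ.2).2

theorem ae_monotone_θ (𝓑 : BermudanFramework P) : ∀ᵐ ω ∂P, Monotone fun k => 𝓑.θ k ω := by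
  filter_upwards [ae_all_iff.2 𝓑.θ_mono] with ω h using monotone_nat_of_le_succ h

/-- Non-increasing sequences in the closure of the grid `θ` are eventually constant. -/
theorem eventually_const_of_antitone {α : Type*} [LinearOrder α] {g : ℕ → α} (hg : Monotone g)
    {top : α} {u : ℕ → α} (hu : Antitone u) (hmem : ∀ n, u n = top ∨ ∃ k, u n = g k) :
    ∃ N, ∀ n, N ≤ n → u n = u N := by
  by_cases h : ∀ n, u n = top
  · exact ⟨0, fun n _ => by rw [h, h]⟩
  obtain ⟨n₀, hn₀⟩ := not_forall.1 h
  have hex : ∃ k, ∃ n, u n = g k := ((hmem n₀).resolve_left hn₀).imp fun k hk => ⟨n₀, hk⟩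
  classical
  by_cases hlow : ∃ N, ∀ n, u N ≤ u n
  · obtain ⟨N, hN⟩ := hlow
    exact ⟨N, fun n hn => le_antisymm (hu hn) (hN n)⟩
  · exfalso
    obtain ⟨N, hN⟩ := Nat.find_spec hex
    push Not at hlow
    obtain ⟨n, hn⟩ := hlow N
    -- A second descent is needed because `top` is not assumed to be the largest element: `u n`
    -- could be `top`, but then `u n'` is a grid value below the least one attained.
    obtain ⟨n', hn'⟩ := hlow n
    have hgrid : ∀ m, (u m = top ∨ g (Nat.find hex) ≤ u m) := by
      intro m
      obtain h | ⟨k, hk⟩ := hmem m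
      · exact Or.inl h
      · exact Or.inr (hk ▸ hg (Nat.find_min' hex ⟨m, hk⟩))
    rcases hgrid n with h1 | h1
    · rcases hgrid n' with h2 | h2
      · rw [h1, h2] at hn'; exact lt_irrefl _ hn'
      · rw [← hN] at h2; exact absurd (hn'.trans hn) (not_lt.2 h2)
    · rw [← hN] at h1; exact absurd hn (not_lt.2 h1)

theorem Strategy.ae_eventually_const {ν : ℕ → 𝓑.Strategy}
    (hν : ∀ᵐ ω ∂P, Antitone fun n => (ν n).1 ω) :
    ∀ᵐ ω ∂P, ∃ N, ∀ n, N ≤ n → (ν n).1 ω = (ν N).1 ω := by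
  filter_upwards [hν, 𝓑.ae_monotone_θ, ae_all_iff.2 fun n => (ν n).ae_mem_grid] with ω h1 h2 h3
  exact eventually_const_of_antitone h2 h1 h3

/-- The limit of a non-increasing sequence of strategies is a strategy, attained eventually. -/
theorem Strategy.exists_limit {ν : ℕ → 𝓑.Strategy} (hν : ∀ᵐ ω ∂P, Antitone fun n => (ν n).1 ω) :
    ∃ τ : 𝓑.Strategy, ∀ᵐ ω ∂P, ∃ N, ∀ n, N ≤ n → (ν n).1 ω = τ.1 ω := by
  classical
  have hc := ae_eventually_const hν
  let Q : Ω → Prop := fun ω => ∃ N, ∀ n, N ≤ n → (ν n).1 ω = (ν N).1 ω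
  let f : Ω → Set.Icc (0 : ℝ) 𝓑.T := fun ω =>
    if h : Q ω then (ν h.choose).1 ω else 𝓑.horizon
  have hf : ∀ᵐ ω ∂P, ∃ N, ∀ n, N ≤ n → (ν n).1 ω = f ω := by
    filter_upwards [hc] with ω (hω : Q ω)
    refine ⟨hω.choose, fun n hn => ?_⟩
    simp only [f, dif_pos hω]
    exact hω.choose_spec n hn
  refine ⟨⟨f, (𝓑.isBermudan_iff _).2 ⟨fun t => ?_, ?_⟩⟩, hf⟩
  -- The limit is defined pathwise by choice, but `{f ≤ t}` agrees almost surely with the event that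
  -- `ν n ≤ t` eventually, and `F t` is complete.
  · have h1 : MeasurableSet[𝓑.F t] (⋃ N, ⋂ n, ⋂ (_ : N ≤ n), {ω | (ν n).1 ω ≤ t}) :=
      MeasurableSet.iUnion fun N => MeasurableSet.iInter fun n => MeasurableSet.iInter fun _ =>
        (ν n).measurableSet_le_const t
    refine measurableSet_congr_ae_of_null (𝓑.complete t) h1 (hf.mono fun ω ⟨N, hN⟩ => ?_)
    simp only [Set.mem_iUnion, Set.mem_iInter, Set.mem_ofPred_eq, WithTop.coe_le_coe]
    constructor
    · rintro ⟨M, hM⟩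
      rw [← hN (max M N) (le_max_right _ _)]
      exact hM _ (le_max_left _ _)
    · exact fun h => ⟨N, fun n hn => hN n hn ▸ h⟩
  · filter_upwards [hf, ae_all_iff.2 fun n => (ν n).ae_mem_grid] with ω ⟨N, hN⟩ h
    rw [← hN N le_rfl]
    exact h N

end StrategyAlgebra

end BermudanFramework

/-! ### Essential suprema as countable suprema, by exhaustion -/

section EssentialSupremum

variable {Ω : Type*} [mΩ : MeasurableSpace Ω] {P : Measure Ω}

theorem IsEssSup.ae_eq {α : Type*} [MeasurableSpace α] [PartialOrder α] {𝒳 : Set (Ω → α)}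
    {V W : Ω → α} (hV : IsEssSup P 𝒳 V) (hW : IsEssSup P 𝒳 W) : ∀ᵐ ω ∂P, V ω = W ω := by
  filter_upwards [hV.2.2 W hW.1 hW.2.1, hW.2.2 V hV.1 hV.2.1] with ω h1 h2 using le_antisymm h1 h2

theorem IsEssInf.ae_eq {α : Type*} [MeasurableSpace α] [PartialOrder α] {𝒳 : Set (Ω → α)}
    {V W : Ω → α} (hV : IsEssInf P 𝒳 V) (hW : IsEssInf P 𝒳 W) : ∀ᵐ ω ∂P, V ω = W ω := by
  filter_upwards [hV.2.2 W hW.1 hW.2.1, hW.2.2 V hV.1 hV.2.1] with ω h1 h2 using le_antisymm h2 h1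

/-- A strictly increasing map from the extended reals to `[0, 1]`. -/
noncomputable def EReal.toUnit (x : EReal) : ℝ≥0∞ :=
  (ENNReal.orderIsoIicOneBirational (EReal.expOrderIso x) : ℝ≥0∞)

theorem EReal.toUnit_strictMono : StrictMono EReal.toUnit := fun x y h => by
  have h1 : EReal.expOrderIso x < EReal.expOrderIso y := EReal.expOrderIso.lt_iff_lt.2 h
  exact Subtype.coe_lt_coe.2 (ENNReal.orderIsoIicOneBirational.lt_iff_lt.2 h1)

theorem EReal.toUnit_le_one (x : EReal) : EReal.toUnit x ≤ 1 :=
  (ENNReal.orderIsoIicOneBirational (EReal.expOrderIso x)).2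

theorem EReal.measurable_toUnit : Measurable EReal.toUnit :=
  EReal.toUnit_strictMono.monotone.measurable

/-- The essential supremum of a non-empty family of extended real random variables exists and is
the supremum of a sequence in the family. -/
theorem exists_seq_isEssSup [IsFiniteMeasure P] {𝒳 : Set (Ω → EReal)} (hne : 𝒳.Nonempty)
    (hm : ∀ g ∈ 𝒳, Measurable g) :
    ∃ g : ℕ → Ω → EReal, (∀ n, g n ∈ 𝒳) ∧ IsEssSup P 𝒳 (fun ω => ⨆ n, g n ω) := by
  let I : (ℕ → 𝒳) → ℝ≥0∞ := fun g => ∫⁻ ω, EReal.toUnit (⨆ n, (g n).1 ω) ∂P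
  obtain ⟨g₀, hg₀⟩ := hne
  have : Nonempty (ℕ → 𝒳) := ⟨fun _ => ⟨g₀, hg₀⟩⟩
  have hsm : ∀ g : ℕ → 𝒳, Measurable fun ω => ⨆ n, (g n).1 ω := fun g =>
    Measurable.iSup fun n => hm _ (g n).2
  obtain ⟨s, -, hs_lim, hs_mem⟩ := exists_seq_tendsto_sSup (S := Set.range I)
    (Set.range_nonempty I) (OrderTop.bddAbove _)
  choose γ hγ using hs_mem
  -- The pairing function merges a maximizing sequence of sequences into one sequence, which attains
  -- the supremum of `I`.
  let g : ℕ → 𝒳 := fun k => γ (Nat.unpair k).1 (Nat.unpair k).2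
  have hIg : I g = sSup (Set.range I) := by
    refine le_antisymm (le_sSup ⟨g, rfl⟩) (le_of_tendsto' hs_lim fun n => ?_)
    rw [← hγ n]
    refine lintegral_mono fun ω => EReal.toUnit_strictMono.monotone (iSup_le fun k => ?_)
    refine le_iSup_of_le (Nat.pair n k) ?_
    simp [g]
  refine ⟨fun n => (g n).1, fun n => (g n).2, hsm g, fun f hf => ?_, fun h _ hh => ?_⟩
  -- Adjoining `f` to the optimal sequence cannot raise the integral; since `toUnit` is strictly
  -- increasing, the supremum itself is unchanged almost everywhere.
  · let g' : ℕ → 𝒳 := fun k => if k = 0 then ⟨f, hf⟩ else g (k - 1)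
    have hle : ∀ ω, (⨆ n, (g n).1 ω) ≤ ⨆ n, (g' n).1 ω := fun ω =>
      iSup_le fun k => le_iSup_of_le (k + 1) (by simp [g'])
    have hfle : ∀ ω, f ω ≤ ⨆ n, (g' n).1 ω := fun ω => le_iSup_of_le 0 (by simp [g'])
    have hint : I g' ≤ I g := hIg ▸ le_sSup ⟨g', rfl⟩
    have hfin : I g ≠ ∞ := by
      refine ne_top_of_le_ne_top (measure_ne_top P Set.univ) ?_
      calc I g ≤ ∫⁻ _, 1 ∂P := lintegral_mono fun ω => EReal.toUnit_le_one _
        _ = P Set.univ := by simp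
    have hae := ae_eq_of_ae_le_of_lintegral_le (μ := P)
      (f := fun ω => EReal.toUnit (⨆ n, (g n).1 ω)) (g := fun ω => EReal.toUnit (⨆ n, (g' n).1 ω))
      (ae_of_all _ fun ω => EReal.toUnit_strictMono.monotone (hle ω)) hfin
      (EReal.measurable_toUnit.comp (hsm g')).aemeasurable hint
    filter_upwards [hae] with ω hω
    exact (hfle ω).trans (EReal.toUnit_strictMono.injective hω).ge
  · filter_upwards [ae_all_iff.2 fun n => hh _ (g n).2] with ω hω using iSup_le hω

end EssentialSupremum

namespace BermudanFramework

/-! ### Assessments against a fixed opponent and their locality -/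

section Assessment

variable {Ω : Type*} [mΩ : MeasurableSpace Ω] {P : Measure Ω} {𝓑 : BermudanFramework P}
  {p : ℝ≥0∞} {ρ : 𝓑.Operators} {X Y φ : 𝓑.Family} {β σ σ' S S' τ : 𝓑.Strategy}

theorem Strategy.InLp.mono {η : Ω → ℝ} (h : S.InLp p η) (hS : S.LE τ) : τ.InLp p η :=
  ⟨h.1.mono (Strategy.sigma_mono hS) le_rfl, h.2⟩

theorem Strategy.InLp.congr_ae {η η' : Ω → ℝ} (h : S.InLp p η) (hη : ∀ᵐ ω ∂P, η ω = η' ω) :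
    S.InLp p η' :=
  ⟨S.measurable_congr_ae h.1 hη, h.2.ae_eq hη⟩

theorem IsAdmissible.inLp (h : IsAdmissible p φ) (τ : 𝓑.Strategy) : τ.InLp p (φ τ) :=
  ⟨h.measurable τ, h.memLp τ⟩

theorem IsEvaluation.congr_ae (hρ : IsEvaluation p ρ) (S : 𝓑.Strategy) {η η' : Ω → ℝ}
    (h : τ.InLp p η) (hη : ∀ᵐ ω ∂P, η ω = η' ω) : ∀ᵐ ω ∂P, ρ S τ η ω = ρ S τ η' ω := by
  have h' := h.congr_ae hη
  filter_upwards [hρ.monotonicity S τ η η' h h' (hη.mono fun _ h => h.le),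
    hρ.monotonicity S τ η' η h' h (hη.mono fun _ h => h.ge)] with ω h1 h2 using le_antisymm h1 h2

theorem IsEvaluation.congr_strategy (hρ : IsEvaluation p ρ) (hφ : IsAdmissible p φ)
    (hS : S.LE σ) (h : ∀ᵐ ω ∂P, σ.1 ω = σ'.1 ω) :
    ∀ᵐ ω ∂P, ρ S σ (φ σ) ω = ρ S σ' (φ σ') ω := by
  have hS' : S.LE σ' := by filter_upwards [hS, h] with ω h1 h2 using h2 ▸ h1
  filter_upwards [hρ.generalized_zero_one φ hφ S σ σ' Set.univ (@MeasurableSet.univ _ (_)) hS hS'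
    (h.mono fun _ h _ => h)] with ω h using h trivial

/-- A family which is `X` on an event depending measurably on the strategy and `Y` elsewhere. -/
theorem IsAdmissible.ite (hX : IsAdmissible p X) (hY : IsAdmissible p Y)
    {A : 𝓑.Strategy → Set Ω} (hA : ∀ τ : 𝓑.Strategy, MeasurableSet[τ.sigma] (A τ))
    (hAc : ∀ τ τ' : 𝓑.Strategy, ∀ ω, τ.1 ω = τ'.1 ω → (ω ∈ A τ ↔ ω ∈ A τ'))
    {φ : 𝓑.Family} (h1 : ∀ τ ω, ω ∈ A τ → φ τ ω = X τ ω) (h2 : ∀ τ ω, ω ∉ A τ → φ τ ω = Y τ ω) :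
    IsAdmissible p φ := by
  classical
  have hφ : ∀ τ, φ τ = fun ω => if ω ∈ A τ then X τ ω else Y τ ω := by
    intro τ
    funext ω
    split_ifs with h
    · exact h1 τ ω h
    · exact h2 τ ω h
  have hm : ∀ τ : 𝓑.Strategy, Measurable[τ.sigma] (φ τ) := fun τ => by
    rw [hφ]
    exact Measurable.ite (m := τ.sigma) (hA τ) (hX.measurable τ) (hY.measurable τ)
  refine ⟨hm, fun τ τ' => ?_, fun τ => ?_⟩
  · filter_upwards [hX.congr τ τ', hY.congr τ τ'] with ω hx hy h
    by_cases hmem : ω ∈ A τ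
    · rw [h1 τ ω hmem, h1 τ' ω ((hAc τ τ' ω h).1 hmem), hx h]
    · rw [h2 τ ω hmem, h2 τ' ω (fun h' => hmem ((hAc τ τ' ω h).2 h')), hy h]
  · refine MemLp.mono ((hX.memLp τ).norm.add (hY.memLp τ).norm)
      ((hm τ).mono τ.sigma_le le_rfl).aestronglyMeasurable (ae_of_all _ fun ω => ?_)
    simp only [Pi.add_apply, Real.norm_eq_abs]
    rw [abs_of_nonneg (by positivity : 0 ≤ |X τ ω| + |Y τ ω|)]
    by_cases hmem : ω ∈ A τ
    · rw [h1 τ ω hmem]; linarith [abs_nonneg (Y τ ω)]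
    · rw [h2 τ ω hmem]; linarith [abs_nonneg (X τ ω)]

theorem stoppingPayoff_of_lt {ω : Ω} (h : σ.1 ω < β.1 ω) :
    stoppingPayoff X Y β σ ω = X σ ω := if_pos h

theorem stoppingPayoff_of_le {ω : Ω} (h : β.1 ω ≤ σ.1 ω) :
    stoppingPayoff X Y β σ ω = Y β ω := if_neg (not_lt.2 h)

/-- Who stops first is known at `σ ∧ β`: each of the two pieces of the pay-off is measurable for
both `F_σ` and `F_β`, hence for the σ-algebra of the minimum. -/
theorem inLp_stoppingPayoff_inf (hX : IsAdmissible p X) (hY : IsAdmissible p Y)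
    (β σ : 𝓑.Strategy) : (σ.inf β).InLp p (stoppingPayoff X Y β σ) := by
  have hm : Measurable[(σ.inf β).sigma] (stoppingPayoff X Y β σ) := by
    intro s hs
    have h1 := hX.measurable σ hs
    have h2 := hY.measurable β hs
    have hset : stoppingPayoff X Y β σ ⁻¹' s
        = (X σ ⁻¹' s ∩ {ω | σ.1 ω < β.1 ω}) ∪ (Y β ⁻¹' s ∩ {ω | β.1 ω ≤ σ.1 ω}) := by
      ext ω
      rcases lt_or_ge (σ.1 ω) (β.1 ω) with h | h
      · simp [stoppingPayoff_of_lt h, h]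
      · simp [stoppingPayoff_of_le h, h]
    rw [hset]
    refine @MeasurableSet.union _ (_) _ _ ((σ.measurableSet_inf_iff β _).2 ⟨?_, ?_⟩)
      ((σ.measurableSet_inf_iff β _).2 ⟨?_, ?_⟩)
    · exact @MeasurableSet.inter _ (_) _ _ h1 (σ.measurableSet_lt_left β)
    · exact Strategy.measurableSet_inter_lt β h1
    · exact Strategy.measurableSet_inter_le σ h2
    · exact @MeasurableSet.inter _ (_) _ _ h2 (β.measurableSet_le_left σ)
  refine ⟨hm, MemLp.mono ((hX.memLp σ).norm.add (hY.memLp β).norm)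
    (hm.mono (σ.inf β).sigma_le le_rfl).aestronglyMeasurable (ae_of_all _ fun ω => ?_)⟩
  simp only [Pi.add_apply, Real.norm_eq_abs]
  rw [abs_of_nonneg (by positivity : 0 ≤ |X σ ω| + |Y β ω|)]
  rcases lt_or_ge (σ.1 ω) (β.1 ω) with h | h
  · rw [stoppingPayoff_of_lt h]; linarith [abs_nonneg (Y β ω)]
  · rw [stoppingPayoff_of_le h]; linarith [abs_nonneg (X σ ω)]

theorem stoppingPayoff_congr (hX : IsAdmissible p X) (β σ σ' : 𝓑.Strategy) :
    ∀ᵐ ω ∂P, σ.1 ω = σ'.1 ω → stoppingPayoff X Y β σ ω = stoppingPayoff X Y β σ' ω := by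
  filter_upwards [hX.congr σ σ'] with ω h heq
  simp only [stoppingPayoff, heq, h heq]

theorem isAdmissible_stoppingPayoff (hX : IsAdmissible p X) (hY : IsAdmissible p Y)
    (β : 𝓑.Strategy) : IsAdmissible p (stoppingPayoff X Y β) where
  measurable σ := ((inLp_stoppingPayoff_inf hX hY β σ).mono (σ.inf_le_left β)).1
  congr σ σ' := stoppingPayoff_congr hX β σ σ'
  memLp σ := (inLp_stoppingPayoff_inf hX hY β σ).2

/-- A tie already pays `Y β`, so truncating `σ` at `β` changes nothing. -/
theorem stoppingPayoff_inf (hX : IsAdmissible p X) (β σ : 𝓑.Strategy) :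
    ∀ᵐ ω ∂P, stoppingPayoff X Y β σ ω = stoppingPayoff X Y β (σ.inf β) ω := by
  filter_upwards [stoppingPayoff_congr (Y := Y) hX β σ (σ.inf β)] with ω h
  rcases le_total (σ.1 ω) (β.1 ω) with h' | h'
  · exact h (by simp [h'])
  · rw [stoppingPayoff_of_le h', stoppingPayoff_of_le (by simp [h'])]

/-- The assessment at time `S` of playing `σ` against `β`. -/
noncomputable def assess (ρ : 𝓑.Operators) (X Y : 𝓑.Family) (β S σ : 𝓑.Strategy) : Ω → ℝ :=
  ρ S (σ.inf β) (stoppingPayoff X Y β σ)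

theorem measurable_assess (hρ : IsEvaluation p ρ) (hX : IsAdmissible p X) (hY : IsAdmissible p Y)
    (β S σ : 𝓑.Strategy) : Measurable[S.sigma] (assess ρ X Y β S σ) :=
  (hρ.maps S _ _ (inLp_stoppingPayoff_inf hX hY β σ)).1

theorem assess_eq_inf (hρ : IsEvaluation p ρ) (hX : IsAdmissible p X) (hY : IsAdmissible p Y)
    (β S σ : 𝓑.Strategy) : ∀ᵐ ω ∂P, assess ρ X Y β S σ ω =
      ρ S (σ.inf β) (stoppingPayoff X Y β (σ.inf β)) ω :=
  hρ.congr_ae S (inLp_stoppingPayoff_inf hX hY β σ) (stoppingPayoff_inf hX β σ)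

theorem assess_congr_time (hρ : IsEvaluation p ρ) (hX : IsAdmissible p X) (hY : IsAdmissible p Y)
    (β S S' σ : 𝓑.Strategy) :
    ∀ᵐ ω ∂P, S.1 ω = S'.1 ω → assess ρ X Y β S σ ω = assess ρ X Y β S' σ ω :=
  hρ.admissibility S S' _ _ (inLp_stoppingPayoff_inf hX hY β σ)

theorem assess_of_inf_le (hρ : IsEvaluation p ρ) (hX : IsAdmissible p X) (hY : IsAdmissible p Y)
    (hS : (σ.inf β).LE S) :
    ∀ᵐ ω ∂P, assess ρ X Y β S σ ω = stoppingPayoff X Y β σ ω :=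
  hρ.knowledge_preservation _ _ _ (inLp_stoppingPayoff_inf hX hY β σ) hS

/-- Once the opponent has stopped, the assessment is the opponent's pay-off. -/
theorem assess_of_opponent_le (hρ : IsEvaluation p ρ) (hX : IsAdmissible p X)
    (hY : IsAdmissible p Y) (hS : S.LE σ) :
    ∀ᵐ ω ∂P, β.1 ω ≤ S.1 ω → assess ρ X Y β S σ ω = Y β ω := by
  have hA : MeasurableSet[S.sigma] {ω | β.1 ω ≤ S.1 ω} := β.measurableSet_le_right S
  have hAT := Strategy.sigma_mono S.le_terminal _ hA
  let S' := Strategy.paste _ S 𝓑.terminal hA hAT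
  have hS' : (σ.inf β).LE S' := by
    refine ae_of_all _ fun ω => ?_
    by_cases h : β.1 ω ≤ S.1 ω
    · rw [Strategy.paste_of_mem hA hAT h]
      exact (min_le_right _ _).trans h
    · rw [Strategy.paste_of_notMem hA hAT h]
      exact le_horizon _
  filter_upwards [assess_congr_time hρ hX hY β S S' σ, assess_of_inf_le hρ hX hY hS', hS]
    with ω h1 h2 h3 h
  rw [h1 (Strategy.paste_of_mem hA hAT h).symm, h2, stoppingPayoff_of_le (h.trans h3)]

/-- The generalized zero-one law requires `S ≤ σ ∧ β`, which fails where `β < S`. Where `β ≤ S` both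
sides are the opponent's pay-off `Y β`; where `S ≤ β`, time `S` may be replaced by `S ∧ β`, to which
the law applies. -/
theorem assess_local (hρ : IsEvaluation p ρ) (hX : IsAdmissible p X) (hY : IsAdmissible p Y)
    (hσ : S.LE σ) (hσ' : S.LE σ') {A : Set Ω} (hA : MeasurableSet[S.sigma] A)
    (h : ∀ᵐ ω ∂P, ω ∈ A → σ.1 ω = σ'.1 ω) :
    ∀ᵐ ω ∂P, ω ∈ A → assess ρ X Y β S σ ω = assess ρ X Y β S σ' ω := by
  have hB : MeasurableSet[(S.inf β).sigma] (A ∩ {ω | S.1 ω ≤ β.1 ω}) :=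
    (S.measurableSet_inf_iff β _).2 ⟨@MeasurableSet.inter _ (_) _ _ hA (S.measurableSet_le_left β),
      Strategy.measurableSet_inter_le β hA⟩
  have hle : ∀ {τ : 𝓑.Strategy}, S.LE τ → (S.inf β).LE (τ.inf β) := fun h =>
    Strategy.le_inf ((S.inf_le_left β).trans h) (S.inf_le_right β)
  filter_upwards [assess_of_opponent_le (β := β) hρ hX hY hσ,
    assess_of_opponent_le (β := β) hρ hX hY hσ',
    assess_congr_time hρ hX hY β S (S.inf β) σ, assess_congr_time hρ hX hY β S (S.inf β) σ',
    assess_eq_inf hρ hX hY β (S.inf β) σ, assess_eq_inf hρ hX hY β (S.inf β) σ',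
    hρ.generalized_zero_one _ (isAdmissible_stoppingPayoff hX hY β) _ _ _ _ hB (hle hσ) (hle hσ')
      (h.mono fun ω h hω => by simp [h hω.1])] with ω h1 h2 h3 h4 h5 h6 h7 hω
  rcases le_total (β.1 ω) (S.1 ω) with h' | h'
  · rw [h1 h', h2 h']
  · have hS : S.1 ω = (S.inf β).1 ω := by simp [h']
    rw [h3 hS, h4 hS, h5, h6, h7 ⟨hω, h'⟩]

theorem assess_self (hρ : IsEvaluation p ρ) (hX : IsAdmissible p X) (hY : IsAdmissible p Y)
    (β S : 𝓑.Strategy) : ∀ᵐ ω ∂P, assess ρ X Y β S S ω = stoppingPayoff X Y β S ω :=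
  assess_of_inf_le hρ hX hY (S.inf_le_left β)

/-- The assessment depends on the opponent's strategy only through its values from now on. -/
theorem assess_congr_opponent (hρ : IsEvaluation p ρ) (hzo : ZeroOneLaw p ρ)
    (hX : IsAdmissible p X) (hY : IsAdmissible p Y) {β' : 𝓑.Strategy} (hβ : β'.LE β)
    (hσ : S.LE σ) (h : ∀ᵐ ω ∂P, S.1 ω < β'.1 ω → β'.1 ω = β.1 ω) :
    ∀ᵐ ω ∂P, S.1 ω < β'.1 ω → assess ρ X Y β' S σ ω = assess ρ X Y β S σ ω := by
  classical
  set A : Set Ω := {ω | S.1 ω < β'.1 ω}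
  have hA : MeasurableSet[(S.inf β').sigma] A := (S.measurableSet_inf_iff β' _).2
    ⟨S.measurableSet_lt_left β', S.measurableSet_lt_right β'⟩
  have hle' : (S.inf β').LE (σ.inf β') :=
    Strategy.le_inf ((S.inf_le_left β').trans hσ) (S.inf_le_right β')
  have hle : (S.inf β').LE (σ.inf β) :=
    Strategy.le_inf ((S.inf_le_left β').trans hσ) ((S.inf_le_right β').trans hβ)
  have hξ := isAdmissible_stoppingPayoff hX hY β
  have hξ' := isAdmissible_stoppingPayoff hX hY β'
  -- The opponent is changed in two moves: first in the pay-off, at the fixed horizon `σ ∧ β'`, by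
  -- the zero-one law on `A`; then in the horizon, from `σ ∧ β'` to `σ ∧ β`, by the generalized law.
  have hind : ∀ᵐ ω ∂P, A.indicator (stoppingPayoff X Y β' (σ.inf β')) ω =
      A.indicator (stoppingPayoff X Y β (σ.inf β')) ω := by
    filter_upwards [h, hY.congr β' β] with ω h1 h2
    by_cases hω : ω ∈ A
    · simp only [Set.indicator_of_mem hω, stoppingPayoff, h1 hω, h2 (h1 hω)]
    · simp only [Set.indicator_of_notMem hω]
  have hAσ : MeasurableSet[(σ.inf β').sigma] A := Strategy.sigma_mono hle' _ hA
  have hin : (σ.inf β').InLp p (A.indicator (stoppingPayoff X Y β' (σ.inf β'))) :=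
    ⟨@Measurable.indicator _ _ (_) _ _ _ _ (hξ'.measurable _) hAσ,
      (hξ'.memLp _).indicator ((σ.inf β').sigma_le _ hAσ)⟩
  filter_upwards [assess_congr_time hρ hX hY β' S (S.inf β') σ,
    assess_congr_time hρ hX hY β S (S.inf β') σ,
    assess_eq_inf hρ hX hY β' (S.inf β') σ, assess_eq_inf hρ hX hY β (S.inf β') σ,
    hzo _ _ A _ hle' hA (hξ'.inLp (σ.inf β')), hzo _ _ A _ hle' hA (hξ.inLp (σ.inf β')),
    hρ.congr_ae (S.inf β') hin hind,
    hρ.generalized_zero_one _ hξ _ _ _ _ hA hle' hle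
      (h.mono fun ω h hω => by simp [h hω])] with ω h1 h2 h3 h4 h5 h6 h7 h8 hω
  have hS : S.1 ω = (S.inf β').1 ω := by simp [(show S.1 ω < β'.1 ω from hω).le]
  rw [h1 hS, h2 hS, h3, h4, h5 hω, h7, ← h6 hω, h8 hω]

end Assessment

/-! ### The value family and its first contact with the pay-off -/

section Value

variable {Ω : Type*} [mΩ : MeasurableSpace Ω] {P : Measure Ω} {𝓑 : BermudanFramework P}
  {p : ℝ≥0∞} {ρ : 𝓑.Operators} {X Y : 𝓑.Family} {β σ S τ : 𝓑.Strategy}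
  {V : 𝓑.Strategy → Ω → EReal}

theorem measurable_assess_coe (hρ : IsEvaluation p ρ) (hX : IsAdmissible p X)
    (hY : IsAdmissible p Y) (β S σ : 𝓑.Strategy) :
    Measurable[S.sigma] fun ω => (assess ρ X Y β S σ ω : EReal) :=
  measurable_coe_real_ereal.comp (measurable_assess hρ hX hY β S σ)

theorem exists_seq_isEssSup_assess [IsFiniteMeasure P] (hρ : IsEvaluation p ρ)
    (hX : IsAdmissible p X) (hY : IsAdmissible p Y) (β S : 𝓑.Strategy) :
    ∃ σ : ℕ → 𝓑.Strategy, (∀ n, S.LE (σ n)) ∧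
      IsEssSup P {g | ∃ σ : 𝓑.Strategy, S.LE σ ∧
        g = fun ω => (ρ S (σ.inf β) (stoppingPayoff X Y β σ) ω : EReal)}
        (fun ω => ⨆ n, (assess ρ X Y β S (σ n) ω : EReal)) := by
  obtain ⟨g, hg, hsup⟩ := exists_seq_isEssSup (P := P) (𝒳 := {g | ∃ σ : 𝓑.Strategy, S.LE σ ∧
    g = fun ω => (ρ S (σ.inf β) (stoppingPayoff X Y β σ) ω : EReal)})
    ⟨_, S, Strategy.LE.refl S, rfl⟩ (by
      rintro _ ⟨σ, -, rfl⟩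
      exact (measurable_assess_coe hρ hX hY β S σ).mono S.sigma_le le_rfl)
  choose σ hσ hgσ using hg
  refine ⟨σ, hσ, ?_⟩
  have : (fun ω => ⨆ n, g n ω) = fun ω => ⨆ n, (assess ρ X Y β S (σ n) ω : EReal) := by
    funext ω
    simp only [hgσ, assess]
  rwa [← this]

theorem exists_isValueFamily [IsFiniteMeasure P] (hρ : IsEvaluation p ρ)
    (hX : IsAdmissible p X) (hY : IsAdmissible p Y) (β : 𝓑.Strategy) :
    ∃ V, IsValueFamily ρ (stoppingPayoff X Y β) β V := by
  choose σ _ hV using exists_seq_isEssSup_assess hρ hX hY β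
  exact ⟨_, hV⟩

theorem IsValueFamily.exists_seq [IsFiniteMeasure P]
    (hV : IsValueFamily ρ (stoppingPayoff X Y β) β V) (hρ : IsEvaluation p ρ)
    (hX : IsAdmissible p X) (hY : IsAdmissible p Y) (S : 𝓑.Strategy) :
    ∃ σ : ℕ → 𝓑.Strategy, (∀ n, S.LE (σ n)) ∧
      ∀ᵐ ω ∂P, V S ω = ⨆ n, (assess ρ X Y β S (σ n) ω : EReal) := by
  obtain ⟨σ, hσ, h⟩ := exists_seq_isEssSup_assess hρ hX hY β S
  exact ⟨σ, hσ, (hV S).ae_eq h⟩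

theorem IsValueFamily.assess_le (hV : IsValueFamily ρ (stoppingPayoff X Y β) β V)
    (h : S.LE σ) : ∀ᵐ ω ∂P, (assess ρ X Y β S σ ω : EReal) ≤ V S ω :=
  (hV S).2.1 _ ⟨σ, h, rfl⟩

/-- Minimality of an essential supremum only handles global measurable bounds; a countable
realization also gives bounds on an event, by a possibly non-measurable `W`. -/
theorem IsValueFamily.le_of_forall [IsFiniteMeasure P]
    (hV : IsValueFamily ρ (stoppingPayoff X Y β) β V) (hρ : IsEvaluation p ρ)
    (hX : IsAdmissible p X) (hY : IsAdmissible p Y) {W : Ω → EReal} {A : Set Ω}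
    (h : ∀ σ : 𝓑.Strategy, S.LE σ → ∀ᵐ ω ∂P, ω ∈ A → (assess ρ X Y β S σ ω : EReal) ≤ W ω) :
    ∀ᵐ ω ∂P, ω ∈ A → V S ω ≤ W ω := by
  obtain ⟨σ, hσ, hseq⟩ := hV.exists_seq hρ hX hY S
  filter_upwards [hseq, ae_all_iff.2 fun n => h (σ n) (hσ n)] with ω h1 h2 hω
  exact h1 ▸ iSup_le fun n => h2 n hω

theorem IsValueFamily.measurable [IsFiniteMeasure P]
    (hV : IsValueFamily ρ (stoppingPayoff X Y β) β V) (hρ : IsEvaluation p ρ)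
    (hX : IsAdmissible p X) (hY : IsAdmissible p Y) (S : 𝓑.Strategy) :
    Measurable[S.sigma] (V S) := by
  obtain ⟨σ, -, hseq⟩ := hV.exists_seq hρ hX hY S
  refine S.measurable_congr_ae ?_ (hseq.mono fun ω h => h.symm)
  exact Measurable.iSup fun n => measurable_assess_coe hρ hX hY β S (σ n)

theorem IsValueFamily.payoff_le (hV : IsValueFamily ρ (stoppingPayoff X Y β) β V)
    (hρ : IsEvaluation p ρ) (hX : IsAdmissible p X) (hY : IsAdmissible p Y) (S : 𝓑.Strategy) :
    ∀ᵐ ω ∂P, (stoppingPayoff X Y β S ω : EReal) ≤ V S ω := by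
  filter_upwards [hV.assess_le (Strategy.LE.refl S), assess_self hρ hX hY β S] with ω h1 h2
  rwa [h2] at h1

/-- A competitor from `S` is sent to `T` off `{S = S'}`. It then competes from `S'` as well, and its
assessment on the event is unaffected. -/
theorem IsValueFamily.congr_le [IsFiniteMeasure P]
    (hV : IsValueFamily ρ (stoppingPayoff X Y β) β V) (hρ : IsEvaluation p ρ)
    (hX : IsAdmissible p X) (hY : IsAdmissible p Y) (S S' : 𝓑.Strategy) :
    ∀ᵐ ω ∂P, S.1 ω = S'.1 ω → V S ω ≤ V S' ω := by
  have hA := S.measurableSet_eq S'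
  have hA' : MeasurableSet[S'.sigma] {ω | S.1 ω = S'.1 ω} := by
    convert S'.measurableSet_eq S using 1
    ext ω; exact eq_comm
  refine hV.le_of_forall hρ hX hY (A := {ω | S.1 ω = S'.1 ω}) fun σ hσ => ?_
  have hAσ := Strategy.sigma_mono hσ _ hA
  have hAT := Strategy.sigma_mono S.le_terminal _ hA
  let σ' := Strategy.paste _ σ 𝓑.terminal hAσ hAT
  have h1 : S.LE σ' := by
    filter_upwards [hσ] with ω h
    by_cases hω : ω ∈ {ω | S.1 ω = S'.1 ω}
    · rw [Strategy.paste_of_mem hAσ hAT hω]; exact h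
    · rw [Strategy.paste_of_notMem hAσ hAT hω]; exact le_horizon _
  have h2 : S'.LE σ' := by
    filter_upwards [hσ] with ω h
    by_cases hω : ω ∈ {ω | S.1 ω = S'.1 ω}
    · rw [Strategy.paste_of_mem hAσ hAT hω, ← show S.1 ω = S'.1 ω from hω]; exact h
    · rw [Strategy.paste_of_notMem hAσ hAT hω]; exact le_horizon _
  filter_upwards [assess_local (β := β) hρ hX hY hσ h1 hA (ae_of_all _ fun ω hω =>
      (Strategy.paste_of_mem hAσ hAT hω).symm), assess_congr_time hρ hX hY β S S' σ',
    hV.assess_le h2] with ω h3 h4 h5 hω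
  rw [h3 hω, h4 hω]
  exact h5

theorem IsValueFamily.congr [IsFiniteMeasure P]
    (hV : IsValueFamily ρ (stoppingPayoff X Y β) β V) (hρ : IsEvaluation p ρ)
    (hX : IsAdmissible p X) (hY : IsAdmissible p Y) (S S' : 𝓑.Strategy) :
    ∀ᵐ ω ∂P, S.1 ω = S'.1 ω → V S ω = V S' ω := by
  filter_upwards [hV.congr_le hρ hX hY S S', hV.congr_le hρ hX hY S' S] with ω h1 h2 h
  exact le_antisymm (h1 h) (h2 h.symm)

theorem IsValueFamily.terminal [IsFiniteMeasure P]
    (hV : IsValueFamily ρ (stoppingPayoff X Y β) β V) (hρ : IsEvaluation p ρ)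
    (hX : IsAdmissible p X) (hY : IsAdmissible p Y) :
    ∀ᵐ ω ∂P, V 𝓑.terminal ω = (stoppingPayoff X Y β 𝓑.terminal ω : EReal) := by
  have h : ∀ᵐ ω ∂P, ω ∈ Set.univ →
      V 𝓑.terminal ω ≤ (stoppingPayoff X Y β 𝓑.terminal ω : EReal) := by
    refine hV.le_of_forall hρ hX hY fun σ hσ => ?_
    filter_upwards [assess_of_inf_le (σ := σ) (β := β) hρ hX hY (Strategy.le_terminal _),
      stoppingPayoff_congr (Y := Y) hX β σ 𝓑.terminal, hσ] with ω h1 h2 h3 _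
    rw [h1, h2 (le_antisymm (le_horizon _) h3)]
  filter_upwards [h, hV.payoff_le hρ hX hY 𝓑.terminal] with ω h1 h2 using le_antisymm (h1 trivial) h2

/-- The strategies at which the value family meets the pay-off. -/
def IsContact (V : 𝓑.Strategy → Ω → EReal) (ξ : 𝓑.Family) (σ : 𝓑.Strategy) : Prop :=
  ∀ᵐ ω ∂P, V σ ω = (ξ σ ω : EReal)

theorem Strategy.measurable_val (σ : 𝓑.Strategy) : Measurable σ.1 :=
  measurable_of_Iic fun t => 𝓑.F.le t _ (σ.measurableSet_le_const t)

/-- Contact along an event `A ∈ F_S` bounds the essential infimum of the contact strategies. -/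
theorem essInf_contact_le [IsFiniteMeasure P]
    (hV : IsValueFamily ρ (stoppingPayoff X Y β) β V) (hρ : IsEvaluation p ρ)
    (hX : IsAdmissible p X) (hY : IsAdmissible p Y) {t : Ω → Set.Icc (0 : ℝ) 𝓑.T}
    (ht : IsEssInf P {g | ∃ σ : 𝓑.Strategy, IsContact V (stoppingPayoff X Y β) σ ∧ g = σ.1} t)
    {A : Set Ω} (hA : MeasurableSet[S.sigma] A)
    (h : ∀ᵐ ω ∂P, ω ∈ A → V S ω = (stoppingPayoff X Y β S ω : EReal)) :
    ∀ᵐ ω ∂P, ω ∈ A → t ω ≤ S.1 ω := by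
  have hAT := Strategy.sigma_mono S.le_terminal _ hA
  let σ := Strategy.paste _ S 𝓑.terminal hA hAT
  have hσ : IsContact V (stoppingPayoff X Y β) σ := by
    filter_upwards [h, hV.congr hρ hX hY σ S, hV.congr hρ hX hY σ 𝓑.terminal,
      hV.terminal hρ hX hY, stoppingPayoff_congr (Y := Y) hX β σ S,
      stoppingPayoff_congr (Y := Y) hX β σ 𝓑.terminal] with ω h1 h2 h3 h4 h5 h6
    by_cases hω : ω ∈ A
    · have := Strategy.paste_of_mem hA hAT hω
      rw [h2 this, h1 hω, h5 this]
    · have := Strategy.paste_of_notMem hA hAT hω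
      rw [h3 this, h4, h6 this]
  filter_upwards [ht.2.1 _ ⟨σ, hσ, rfl⟩] with ω h1 hω
  rwa [Strategy.paste_of_mem hA hAT hω] at h1

/-- Contact at `S` on an event forces the essential infimum below `S` there, so strictly before it
the inequality between pay-off and value cannot be an equality. This is the source of strict
improvements. -/
theorem payoff_lt_value_of_lt_essInf [IsFiniteMeasure P]
    (hV : IsValueFamily ρ (stoppingPayoff X Y β) β V) (hρ : IsEvaluation p ρ)
    (hX : IsAdmissible p X) (hY : IsAdmissible p Y) {t : Ω → Set.Icc (0 : ℝ) 𝓑.T}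
    (ht : IsEssInf P {g | ∃ σ : 𝓑.Strategy, IsContact V (stoppingPayoff X Y β) σ ∧ g = σ.1} t)
    (S : 𝓑.Strategy) :
    ∀ᵐ ω ∂P, S.1 ω < t ω → (stoppingPayoff X Y β S ω : EReal) < V S ω := by
  have hA : MeasurableSet[S.sigma] {ω | V S ω = (stoppingPayoff X Y β S ω : EReal)} :=
    measurableSet_eq_fun (m := S.sigma) (hV.measurable hρ hX hY S)
      (measurable_coe_real_ereal.comp ((isAdmissible_stoppingPayoff hX hY β).measurable S))
  filter_upwards [essInf_contact_le hV hρ hX hY ht hA (ae_of_all _ fun _ h => h),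
    hV.payoff_le hρ hX hY S] with ω h1 h2 h3
  exact lt_of_le_of_ne h2 fun h => absurd h3 (not_lt.2 (h1 h.symm))

theorem IsContact.inf [IsFiniteMeasure P]
    (hV : IsValueFamily ρ (stoppingPayoff X Y β) β V) (hρ : IsEvaluation p ρ)
    (hX : IsAdmissible p X) (hY : IsAdmissible p Y)
    (hσ : IsContact V (stoppingPayoff X Y β) σ) (hτ : IsContact V (stoppingPayoff X Y β) τ) :
    IsContact V (stoppingPayoff X Y β) (σ.inf τ) := by
  filter_upwards [hσ, hτ, hV.congr hρ hX hY (σ.inf τ) σ, hV.congr hρ hX hY (σ.inf τ) τ,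
    stoppingPayoff_congr (Y := Y) hX β (σ.inf τ) σ,
    stoppingPayoff_congr (Y := Y) hX β (σ.inf τ) τ] with ω h1 h2 h3 h4 h5 h6
  rcases le_total (σ.1 ω) (τ.1 ω) with h | h
  · have : (σ.inf τ).1 ω = σ.1 ω := by simp [h]
    rw [h3 this, h5 this, h1]
  · have : (σ.inf τ).1 ω = τ.1 ω := by simp [h]
    rw [h4 this, h6 this, h2]

/-- The running minimum of a sequence of strategies. -/
def Strategy.runningInf (σ : ℕ → 𝓑.Strategy) : ℕ → 𝓑.Strategy
  | 0 => σ 0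
  | n + 1 => (Strategy.runningInf σ n).inf (σ (n + 1))

theorem Strategy.antitone_runningInf (σ : ℕ → 𝓑.Strategy) (ω : Ω) :
    Antitone fun n => (runningInf σ n).1 ω :=
  antitone_nat_of_succ_le fun n => by simp only [runningInf, inf_val]; exact min_le_left _ _

theorem Strategy.runningInf_le (σ : ℕ → 𝓑.Strategy) (n : ℕ) (ω : Ω) :
    (runningInf σ n).1 ω ≤ (σ n).1 ω := by
  cases n with
  | zero => exact le_rfl
  | succ n => exact min_le_right _ _

theorem Strategy.le_runningInf {σ : ℕ → 𝓑.Strategy} {ω : Ω} {x : Set.Icc (0 : ℝ) 𝓑.T}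
    (h : ∀ n, x ≤ (σ n).1 ω) (n : ℕ) : x ≤ (runningInf σ n).1 ω := by
  induction n with
  | zero => exact h 0
  | succ n ih => exact _root_.le_min ih (h _)

/-- The essential infimum of the contact strategies is attained by a contact strategy. -/
theorem exists_contact_isEssInf [IsFiniteMeasure P]
    (hV : IsValueFamily ρ (stoppingPayoff X Y β) β V) (hρ : IsEvaluation p ρ)
    (hX : IsAdmissible p X) (hY : IsAdmissible p Y) :
    ∃ τ : 𝓑.Strategy, IsContact V (stoppingPayoff X Y β) τ ∧
      IsEssInf P {g | ∃ σ : 𝓑.Strategy, IsContact V (stoppingPayoff X Y β) σ ∧ g = σ.1} τ.1 := by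
  -- The infimum is realized by a sequence via the essential supremum of the `-σ`. Running minima
  -- remain contacts and are stationary path by path, so contact survives in the limit.
  obtain ⟨g, hg, hsup⟩ := exists_seq_isEssSup (P := P) (𝒳 := {g | ∃ σ : 𝓑.Strategy,
    IsContact V (stoppingPayoff X Y β) σ ∧ g = fun ω => ((-(σ.1 ω : ℝ) : ℝ) : EReal)})
    ⟨_, 𝓑.terminal, hV.terminal hρ hX hY, rfl⟩ (by
      rintro _ ⟨σ, -, rfl⟩
      exact measurable_coe_real_ereal.comp (measurable_subtype_coe.comp σ.measurable_val).neg)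
  choose σ hσ hgσ using hg
  obtain ⟨τ, hτ⟩ := Strategy.exists_limit (ν := Strategy.runningInf σ)
    (ae_of_all _ (Strategy.antitone_runningInf σ))
  have hm : ∀ n, IsContact V (stoppingPayoff X Y β) (Strategy.runningInf σ n) := by
    intro n
    induction n with
    | zero => exact hσ 0
    | succ n ih => exact IsContact.inf hV hρ hX hY ih (hσ _)
  have hle : ∀ᵐ ω ∂P, ∀ n, τ.1 ω ≤ (σ n).1 ω := by
    filter_upwards [hτ] with ω ⟨N, hN⟩ n
    rw [← hN (max N n) (le_max_left _ _)]
    exact (Strategy.antitone_runningInf σ ω (le_max_right N n)).trans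
      (Strategy.runningInf_le σ n ω)
  refine ⟨τ, ?_, τ.measurable_val, ?_, ?_⟩
  · filter_upwards [hτ, ae_all_iff.2 hm,
      ae_all_iff.2 fun n => hV.congr hρ hX hY (Strategy.runningInf σ n) τ,
      ae_all_iff.2 fun n => stoppingPayoff_congr (Y := Y) hX β (Strategy.runningInf σ n) τ]
      with ω ⟨N, hN⟩ h1 h2 h3
    rw [← h2 N (hN N le_rfl), ← h3 N (hN N le_rfl), h1 N]
  · rintro _ ⟨s, hs, rfl⟩
    filter_upwards [hsup.2.1 _ ⟨s, hs, rfl⟩, hle] with ω h1 h2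
    have h3 : ((-(s.1 ω : ℝ) : ℝ) : EReal) ≤ ((-(τ.1 ω : ℝ) : ℝ) : EReal) := by
      refine h1.trans (iSup_le fun n => ?_)
      rw [hgσ n]
      exact EReal.coe_le_coe_iff.2 (neg_le_neg (h2 n))
    exact Subtype.coe_le_coe.1 (neg_le_neg_iff.1 (EReal.coe_le_coe_iff.1 h3))
  · intro h _ hh
    filter_upwards [hτ, ae_all_iff.2 fun n => hh _ ⟨_, hσ n, rfl⟩] with ω ⟨N, hN⟩ h2
    rw [← hN N le_rfl]
    exact Strategy.le_runningInf h2 N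

end Value

/-! ### Optimality of the first contact -/

section Optimality

variable {Ω : Type*} [mΩ : MeasurableSpace Ω] {P : Measure Ω} {𝓑 : BermudanFramework P}
  {p : ℝ≥0∞} {ρ : 𝓑.Operators} {X Y φ : 𝓑.Family} {β σ S τ : 𝓑.Strategy}
  {V : 𝓑.Strategy → Ω → EReal}

/-- A sequence in the grid `g ∪ {top}` that increases strictly as long as it is below `t` either
reaches `t` or runs through a subsequence of the grid. -/
theorem reaches_or_subsequence {α : Type*} [LinearOrder α] {g : ℕ → α} (hg : Monotone g) {top t : α}
    (htop : t ≤ top) {s : ℕ → α} (hs : Monotone s) (hst : ∀ n, s n ≤ t)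
    (hlt : ∀ n, s n < t → s n < s (n + 1)) (hmem : ∀ n, s n = top ∨ ∃ k, s n = g k) :
    (∃ N, ∀ n, N ≤ n → s n = t) ∨ ∃ k : ℕ → ℕ, StrictMono k ∧ ∀ n, s n = g (k n) := by
  by_cases h : ∃ N, s N = t
  · obtain ⟨N, hN⟩ := h
    exact Or.inl ⟨N, fun n hn => le_antisymm (hst n) (hN ▸ hs hn)⟩
  · push Not at h
    have hlt' : ∀ n, s n < t := fun n => lt_of_le_of_ne (hst n) (h n)
    have hk : ∀ n, ∃ k, s n = g k := fun n =>
      (hmem n).resolve_left ((hlt' n).trans_le htop).ne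
    choose k hk using hk
    refine Or.inr ⟨k, strictMono_nat_of_lt_succ fun n => ?_, hk⟩
    have := hlt n (hlt' n)
    rw [hk, hk (n + 1)] at this
    exact hg.reflect_lt this

theorem ae_tendsto_θ (𝓑 : BermudanFramework P) :
    ∀ᵐ ω ∂P, Tendsto (fun k => 𝓑.θ k ω) atTop (𝓝 𝓑.horizon) := by
  filter_upwards [𝓑.θ_lim] with ω h using tendsto_subtype_rng.2 h

/-- If every strategy before `t` can be improved strictly, then `t` is optimal. -/
theorem le_of_improvement (hρ : IsEvaluation p ρ) (hφ : IsAdmissible p φ) {Z : Ω → ℝ}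
    (hZ : MemLp Z p P) (hφZ : ∀ σ : 𝓑.Strategy, ∀ᵐ ω ∂P, |φ σ ω| ≤ Z ω)
    (hlim : ∀ᵐ ω ∂P, limsup (fun k => (φ (𝓑.theta k) ω : EReal)) atTop ≤ (φ 𝓑.terminal ω : EReal))
    {t : 𝓑.Strategy}
    (himp : ∀ S : 𝓑.Strategy, S.LE t → ∃ S' : 𝓑.Strategy, S.LE S' ∧ S'.LE t ∧
      (∀ᵐ ω ∂P, S.1 ω < t.1 ω → S.1 ω < S'.1 ω) ∧ ∀ᵐ ω ∂P, φ S ω ≤ ρ S S' (φ S') ω)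
    (hσ : σ.LE t) (hS : S.LE σ) : ∀ᵐ ω ∂P, ρ S σ (φ σ) ω ≤ ρ S t (φ t) ω := by
  choose next hn1 hn2 hn3 hn4 using himp
  -- Iterated improvement from `σ`: by consistency and monotonicity the assessments at `S` never
  -- fall below that of `σ`.
  let seq : ℕ → {τ : 𝓑.Strategy // τ.LE t} := fun n =>
    Nat.rec ⟨σ, hσ⟩ (fun _ τ => ⟨next τ.1 τ.2, hn2 τ.1 τ.2⟩) n
  let s : ℕ → 𝓑.Strategy := fun n => (seq n).1
  have hst : ∀ n, (s n).LE t := fun n => (seq n).2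
  have hs1 : ∀ n, (s n).LE (s (n + 1)) := fun n => hn1 _ (hst n)
  have hSs : ∀ n, S.LE (s n) := by
    intro n
    induction n with
    | zero => exact hS
    | succ n ih => exact ih.trans (hs1 n)
  have hval : ∀ n, ∀ᵐ ω ∂P, ρ S σ (φ σ) ω ≤ ρ S (s n) (φ (s n)) ω := by
    intro n
    induction n with
    | zero => exact ae_of_all _ fun _ => le_rfl
    | succ n ih =>
      filter_upwards [ih, hρ.monotonicity S (s n) _ _ (hφ.inLp _)
        (hρ.maps (s n) (s (n + 1)) _ (hφ.inLp _)) (hn4 _ (hst n)),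
        hρ.consistency S (s n) (s (n + 1)) _ (hφ.inLp _) (hSs n) (hs1 n)] with ω h1 h2 h3
      exact h1.trans (h2.trans h3.le)
  have hmono : ∀ᵐ ω ∂P, Monotone fun n => (s n).1 ω :=
    (ae_all_iff.2 hs1).mono fun ω h => monotone_nat_of_le_succ h
  have hdich : ∀ᵐ ω ∂P, (∃ N, ∀ n, N ≤ n → (s n).1 ω = t.1 ω) ∨
      ∃ k : ℕ → ℕ, StrictMono k ∧ ∀ n, (s n).1 ω = 𝓑.θ (k n) ω := by
    filter_upwards [hmono, 𝓑.ae_monotone_θ, ae_all_iff.2 hst,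
      ae_all_iff.2 fun n => hn3 _ (hst n), ae_all_iff.2 fun n => (s n).ae_mem_grid]
      with ω h1 h2 h3 h4 h5
    exact reaches_or_subsequence h2 (le_horizon _) h1 h3 h4 h5
  have htend : ∀ᵐ ω ∂P, Tendsto (fun n => (s n).1 ω) atTop (𝓝 (t.1 ω)) ∧
      limsup (fun n => (φ (s n) ω : EReal)) atTop ≤ (φ t ω : EReal) := by
    filter_upwards [hdich, 𝓑.ae_tendsto_θ, ae_all_iff.2 hst, hlim, hφ.congr t 𝓑.terminal,
      ae_all_iff.2 fun n => hφ.congr (s n) t,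
      ae_all_iff.2 fun n => ae_all_iff.2 fun k => hφ.congr (s n) (𝓑.theta k)]
      with ω h1 h2 h3 h4 h5 h6 h7
    rcases h1 with ⟨N, hN⟩ | ⟨k, hk, hsk⟩
    · have he : ∀ᶠ n in atTop, (s n).1 ω = t.1 ω := eventually_atTop.2 ⟨N, hN⟩
      refine ⟨tendsto_const_nhds.congr' (he.mono fun n h => h.symm), ?_⟩
      rw [limsup_congr (he.mono fun n h => by rw [h6 n h]), limsup_const]
    -- A path through a subsequence of the grid converges to `T`, which forces `t = T`; the limsup
    -- along the subsequence is then controlled by `hlim`.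
    · have hlimk : Tendsto (fun n => (s n).1 ω) atTop (𝓝 𝓑.horizon) := by
        simp only [hsk]
        exact h2.comp hk.tendsto_atTop
      have ht : t.1 ω = 𝓑.horizon := le_antisymm (le_horizon _) (le_of_tendsto' hlimk h3)
      refine ⟨ht ▸ hlimk, ?_⟩
      rw [h5 ht]
      refine le_trans ?_ h4
      have : (fun n => (φ (s n) ω : EReal)) = (fun k => (φ (𝓑.theta k) ω : EReal)) ∘ k := by
        funext n
        simp only [Function.comp, h7 n (k n) (hsk n)]
      rw [this, Filter.limsup_comp]
      exact limsup_le_limsup_of_le hk.tendsto_atTop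
  -- Left-upper-semicontinuity needs a real version of the limsup; the bound `Z` keeps it finite and
  -- in `L^p`.
  let η : Ω → ℝ := fun ω => (limsup (fun n => (φ (s n) ω : EReal)) atTop).toReal
  have hbd : ∀ᵐ ω ∂P, |η ω| ≤ Z ω ∧
      (η ω : EReal) = limsup (fun n => (φ (s n) ω : EReal)) atTop := by
    filter_upwards [ae_all_iff.2 fun n => hφZ (s n)] with ω h
    have hu : limsup (fun n => (φ (s n) ω : EReal)) atTop ≤ (Z ω : EReal) := by
      rw [← limsup_const (f := (atTop : Filter ℕ)) (Z ω : EReal)]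
      exact limsup_le_limsup (Eventually.of_forall fun n =>
        EReal.coe_le_coe_iff.2 (abs_le.1 (h n)).2)
    have hl : ((-Z ω : ℝ) : EReal) ≤ limsup (fun n => (φ (s n) ω : EReal)) atTop := by
      rw [← limsup_const (f := (atTop : Filter ℕ)) ((-Z ω : ℝ) : EReal)]
      exact limsup_le_limsup (Eventually.of_forall fun n =>
        EReal.coe_le_coe_iff.2 (abs_le.1 (h n)).1)
    have he : (η ω : EReal) = limsup (fun n => (φ (s n) ω : EReal)) atTop :=
      EReal.coe_toReal (ne_top_of_le_ne_top (EReal.coe_ne_top _) hu)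
        (ne_bot_of_le_ne_bot (EReal.coe_ne_bot _) hl)
    rw [← he] at hu hl
    exact ⟨abs_le.2 ⟨EReal.coe_le_coe_iff.1 hl, EReal.coe_le_coe_iff.1 hu⟩, he⟩
  have hηm : Measurable[t.sigma] η := by
    refine measurable_ereal_toReal.comp ?_
    exact Measurable.limsup fun n => measurable_coe_real_ereal.comp
      ((hφ.measurable (s n)).mono (Strategy.sigma_mono (hst n)) le_rfl)
  have hη : t.InLp p η := ⟨hηm, hZ.mono (hηm.mono t.sigma_le le_rfl).aestronglyMeasurable
    (hbd.mono fun ω h => (h.1.trans (le_abs_self _)))⟩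
  filter_upwards [ae_all_iff.2 hval,
    hρ.lusc φ hφ S t s hSs hmono (htend.mono fun _ h => h.1) ⟨Z, hZ, fun n => hφZ (s n)⟩ η hη
      (hbd.mono fun _ h => h.2),
    hρ.monotonicity S t η (φ t) hη (hφ.inLp t) (by
      filter_upwards [htend, hbd] with ω h1 h2
      exact EReal.coe_le_coe_iff.1 (h2.2.trans_le h1.2))] with ω h1 h2 h3
  refine le_trans ?_ h3
  rw [← EReal.coe_le_coe_iff]
  refine le_trans ?_ h2
  rw [← limsup_const (f := (atTop : Filter ℕ)) (ρ S σ (φ σ) ω : EReal)]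
  exact limsup_le_limsup (Eventually.of_forall fun n => EReal.coe_le_coe_iff.2 (h1 n))

theorem exists_bound_stoppingPayoff (h : IsPayoff p X Y) (β : 𝓑.Strategy) :
    ∃ Z : Ω → ℝ, MemLp Z p P ∧
      ∀ σ : 𝓑.Strategy, ∀ᵐ ω ∂P, |stoppingPayoff X Y β σ ω| ≤ Z ω := by
  obtain ⟨Z₁, h1, h1p⟩ := h.essSup_X
  obtain ⟨Z₂, h2, h2p⟩ := h.essSup_Y
  refine ⟨Z₁ + Z₂, h1p.add h2p, fun σ => ?_⟩
  filter_upwards [h1.2.1 _ ⟨σ, rfl⟩, h2.2.1 _ ⟨β, rfl⟩] with ω hx hy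
  simp only [Pi.add_apply, stoppingPayoff]
  split_ifs
  · linarith [abs_nonneg (Y β ω)]
  · linarith [abs_nonneg (X σ ω)]

/-- If `β < T`, the pay-off is eventually frozen at `Y β`. If `β = T`, it equals `X (θ k)`, even
once `θ k = T` because `X` and `Y` agree there, and (A4) applies. -/
theorem limsup_stoppingPayoff_le (h : IsPayoff p X Y) (β : 𝓑.Strategy) :
    ∀ᵐ ω ∂P, limsup (fun k => (stoppingPayoff X Y β (𝓑.theta k) ω : EReal)) atTop ≤
      (stoppingPayoff X Y β 𝓑.terminal ω : EReal) := by
  filter_upwards [𝓑.ae_tendsto_θ, h.limsup_le, h.terminal_eq, h.admissible_Y.congr β 𝓑.terminal,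
    ae_all_iff.2 fun k => h.admissible_X.congr (𝓑.theta k) 𝓑.terminal] with ω h1 h2 h3 h4 h5
  rw [stoppingPayoff_of_le (σ := 𝓑.terminal) (le_horizon _)]
  rcases (le_horizon (β.1 ω)).lt_or_eq with hβ | hβ
  · have he : ∀ᶠ k in atTop, (stoppingPayoff X Y β (𝓑.theta k) ω : EReal) = (Y β ω : EReal) := by
      filter_upwards [h1.eventually_const_lt hβ] with k hk
      rw [stoppingPayoff_of_le hk.le]
    rw [limsup_congr he, limsup_const]
  · rw [h4 hβ, ← h3]
    refine le_trans (le_of_eq (limsup_congr (Eventually.of_forall fun k => ?_))) h2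
    rcases lt_or_ge ((𝓑.theta k).1 ω) (β.1 ω) with hk | hk
    · rw [stoppingPayoff_of_lt hk]
    · rw [stoppingPayoff_of_le hk, h4 hβ, ← h3, h5 k (le_antisymm (le_horizon _) (hβ.symm.trans_le hk))]

/-- Stopping at a contact strategy at the latest does not decrease the assessment. -/
theorem le_stopped_at_contact [IsFiniteMeasure P]
    (hV : IsValueFamily ρ (stoppingPayoff X Y β) β V) (hρ : IsEvaluation p ρ)
    (hX : IsAdmissible p X) (hY : IsAdmissible p Y) (hτ : IsContact V (stoppingPayoff X Y β) τ)
    (hS : S.LE ((σ.inf β).inf τ)) :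
    ∀ᵐ ω ∂P, assess ρ X Y β S σ ω ≤
      ρ S ((σ.inf β).inf τ) (stoppingPayoff X Y β ((σ.inf β).inf τ)) ω := by
  have hξ := isAdmissible_stoppingPayoff hX hY β
  set U := (σ.inf β).inf τ with hU
  have hUσ' : U.LE (σ.inf β) := (σ.inf β).inf_le_left τ
  have hUσ : U.LE σ := hUσ'.trans (σ.inf_le_left β)
  have hA : MeasurableSet[U.sigma] {ω | U.1 ω = (σ.inf β).1 ω} := U.measurableSet_eq _
  -- At `U` either `σ ∧ β` has been reached, or `U = τ` and continuing is worth at most the value,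
  -- which is the pay-off there.
  have hle : ∀ᵐ ω ∂P, ρ U (σ.inf β) (stoppingPayoff X Y β (σ.inf β)) ω ≤
      stoppingPayoff X Y β U ω := by
    filter_upwards [assess_eq_inf hρ hX hY β U σ, hV.assess_le hUσ, hV.congr hρ hX hY U τ, hτ,
      hξ.congr U τ, hρ.generalized_zero_one _ hξ _ _ _ _ hA hUσ' (Strategy.LE.refl U)
        (ae_of_all _ fun ω h => h.symm),
      hρ.knowledge_preservation U U _ (hξ.inLp U) (Strategy.LE.refl U)] with ω h1 h2 h3 h4 h5 h6 h7
    rcases min_choice ((σ.inf β).1 ω) (τ.1 ω) with h | h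
    · rw [h6 h, h7]
    · rw [← h1, ← EReal.coe_le_coe_iff]
      refine h2.trans ?_
      rw [h3 h, h4, h5 h]
  filter_upwards [assess_eq_inf hρ hX hY β S σ,
    hρ.consistency S U (σ.inf β) _ (hξ.inLp _) hS hUσ',
    hρ.monotonicity S U _ _ (hρ.maps U (σ.inf β) _ (hξ.inLp _)) (hξ.inLp U) hle] with ω h1 h2 h3
  rw [h1, ← h2]
  exact h3

/-- Before the first contact, every strategy can be improved strictly. -/
theorem exists_improvement [IsFiniteMeasure P]
    (hV : IsValueFamily ρ (stoppingPayoff X Y β) β V) (hρ : IsEvaluation p ρ)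
    (hX : IsAdmissible p X) (hY : IsAdmissible p Y) (hτ : IsContact V (stoppingPayoff X Y β) τ)
    (hinf : IsEssInf P
      {g | ∃ σ : 𝓑.Strategy, IsContact V (stoppingPayoff X Y β) σ ∧ g = σ.1} τ.1)
    (hS : S.LE (β.inf τ)) :
    ∃ S' : 𝓑.Strategy, S.LE S' ∧ S'.LE (β.inf τ) ∧
      (∀ᵐ ω ∂P, S.1 ω < (β.inf τ).1 ω → S.1 ω < S'.1 ω) ∧
      ∀ᵐ ω ∂P, stoppingPayoff X Y β S ω ≤ ρ S S' (stoppingPayoff X Y β S') ω := by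
  classical
  have hξ := isAdmissible_stoppingPayoff hX hY β
  obtain ⟨σ, hσ, hseq⟩ := hV.exists_seq hρ hX hY S
  let U : ℕ → 𝓑.Strategy := fun k => ((σ k).inf β).inf τ
  have hSU : ∀ k, S.LE (U k) := fun k => by
    filter_upwards [hS, hσ k] with ω h1 h2
    have h3 := _root_.le_min_iff.1 h1
    exact _root_.le_min (_root_.le_min h2 h3.1) h3.2
  let B : ℕ → Set Ω := fun k => {ω | stoppingPayoff X Y β S ω < assess ρ X Y β S (σ k) ω}
  have hB : ∀ k, MeasurableSet[S.sigma] (B k) := fun k =>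
    measurableSet_lt (hξ.measurable S) (measurable_assess hρ hX hY β S (σ k))
  -- Index `0` means that no listed competitor beats stopping at `S`; otherwise `n` is one plus the
  -- first index that does, matching the shift in `s`.
  let n : Ω → ℕ := fun ω => if h : ∃ k, ω ∈ B k then Nat.find h + 1 else 0
  have hn0 : {ω | n ω = 0} = ⋂ k, (B k)ᶜ := by
    ext ω
    simp [n]
  have hnk : ∀ k, {ω | n ω = k + 1} = B k ∩ ⋂ j, ⋂ (_ : j < k), (B j)ᶜ := by
    intro k
    ext ω
    by_cases h : ∃ k, ω ∈ B k
    · simp [n, h, Nat.find_eq_iff]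
    · have : ω ∉ B k := fun h' => h ⟨k, h'⟩
      simp [n, h, this]
  have hnS : ∀ k, MeasurableSet[S.sigma] {ω | n ω = k} := by
    rintro (_ | k)
    · rw [hn0]
      exact MeasurableSet.iInter fun k => (hB k).compl
    · rw [hnk]
      exact MeasurableSet.inter (hB k)
        (MeasurableSet.iInter fun j => MeasurableSet.iInter fun _ => (hB j).compl)
  let s : ℕ → 𝓑.Strategy := fun k => Nat.casesOn k S U
  have hSs : ∀ k, S.LE (s k) := by
    rintro (_ | k)
    · exact Strategy.LE.refl S
    · exact hSU k
  have hns : ∀ k, MeasurableSet[(s k).sigma] {ω | n ω = k} := fun k =>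
    Strategy.sigma_mono (hSs k) _ (hnS k)
  let S' := Strategy.pasteSeq s n hns
  have hS' : S.LE S' := (ae_all_iff.2 hSs).mono fun ω h => h (n ω)
  have hS't : S'.LE (β.inf τ) := by
    have : ∀ k, (s k).LE (β.inf τ) := by
      rintro (_ | k)
      · exact hS
      · exact ae_of_all _ fun ω => _root_.le_min
          ((min_le_left _ _).trans (min_le_right _ _)) (min_le_right _ _)
    exact (ae_all_iff.2 this).mono fun ω h => h (n ω)
  have hself := hρ.knowledge_preservation S S _ (hξ.inLp S) (Strategy.LE.refl S)
  have hpaste : ∀ k, ∀ᵐ ω ∂P, n ω = k →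
      ρ S S' (stoppingPayoff X Y β S') ω = ρ S (s k) (stoppingPayoff X Y β (s k)) ω := fun k =>
    hρ.generalized_zero_one _ hξ S S' (s k) {ω | n ω = k} (hnS k) hS' (hSs k)
      (ae_of_all _ fun ω (hω : n ω = k) => by simp [S', Strategy.pasteSeq, hω])
  have hgt : ∀ᵐ ω ∂P, n ω ≠ 0 →
      stoppingPayoff X Y β S ω < ρ S S' (stoppingPayoff X Y β S') ω := by
    filter_upwards [ae_all_iff.2 hpaste,
      ae_all_iff.2 fun k => le_stopped_at_contact (σ := σ k) hV hρ hX hY hτ (hSU k)]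
      with ω h1 h2 h3
    obtain ⟨k, hk⟩ := Nat.exists_eq_succ_of_ne_zero h3
    have hωB : ω ∈ B k := by
      have : ω ∈ {ω | n ω = k + 1} := hk
      rw [hnk] at this
      exact this.1
    rw [h1 _ hk]
    exact lt_of_lt_of_le hωB (h2 k)
  refine ⟨S', hS', hS't, ?_, ?_⟩
  · filter_upwards [hgt, hseq, payoff_lt_value_of_lt_essInf hV hρ hX hY hinf S, hS', hself,
      hρ.generalized_zero_one _ hξ S S' S _ (S.measurableSet_eq S') hS' (Strategy.LE.refl S)
        (ae_of_all _ fun ω h => h.symm)] with ω h1 h2 h3 h4 h5 h6 hlt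
    -- Below the first contact some competitor beats stopping at `S`. If `S'` stayed at `S`, its
    -- assessment would be the pay-off at `S`, against the strict gain.
    refine lt_of_le_of_ne h4 fun heq => ?_
    have h7 := h3 (hlt.trans_le (min_le_right _ _))
    rw [h2] at h7
    obtain ⟨k, hk⟩ := lt_iSup_iff.1 h7
    have hne : n ω ≠ 0 := by
      have hex : ∃ k, ω ∈ B k := ⟨k, EReal.coe_lt_coe_iff.1 hk⟩
      simp [n, hex]
    have := h1 hne
    rw [h6 heq, h5] at this
    exact lt_irrefl _ this
  · filter_upwards [hgt, hpaste 0, hself] with ω h1 h2 h3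
    by_cases h : n ω = 0
    · rw [h2 h]; exact h3.ge
    · exact (h1 h).le

/-- The first contact strategy is a best response. -/
theorem assess_le_firstContact [IsFiniteMeasure P]
    (hV : IsValueFamily ρ (stoppingPayoff X Y β) β V) (hρ : IsEvaluation p ρ)
    (h : IsPayoff p X Y) (hτ : IsContact V (stoppingPayoff X Y β) τ)
    (hinf : IsEssInf P
      {g | ∃ σ : 𝓑.Strategy, IsContact V (stoppingPayoff X Y β) σ ∧ g = σ.1} τ.1)
    (σ : 𝓑.Strategy) :
    ∀ᵐ ω ∂P, assess ρ X Y β (𝓑.theta 0) σ ω ≤ assess ρ X Y β (𝓑.theta 0) τ ω := by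
  have hX := h.admissible_X
  have hY := h.admissible_Y
  obtain ⟨Z, hZ, hφZ⟩ := exists_bound_stoppingPayoff h β
  filter_upwards [le_stopped_at_contact (σ := σ) hV hρ hX hY hτ (Strategy.theta_zero_le _),
    le_of_improvement (S := 𝓑.theta 0) (σ := (σ.inf β).inf τ) (t := β.inf τ) hρ
      (isAdmissible_stoppingPayoff hX hY β) hZ hφZ (limsup_stoppingPayoff_le h β)
      (fun S hS => exists_improvement hV hρ hX hY hτ hinf hS)
      (ae_of_all _ fun ω => min_le_min_right _ (min_le_right _ _)) (Strategy.theta_zero_le _),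
    assess_eq_inf hρ hX hY β (𝓑.theta 0) τ] with ω h1 h2 h3
  rw [h3, τ.inf_comm β]
  exact h1.trans h2

end Optimality

/-! ### Best responses survive the opponent's update -/

section BestResponse

variable {Ω : Type*} [mΩ : MeasurableSpace Ω] {P : Measure Ω} {𝓑 : BermudanFramework P}
  {p : ℝ≥0∞} {ρ : 𝓑.Operators} {X Y φ : 𝓑.Family} {α β σ S τ : 𝓑.Strategy}
  {V : 𝓑.Strategy → Ω → EReal}

/-- `τ` is optimal against `β`, and the value family touches the pay-off at `τ` on `{τ < β}`. -/
def IsBestResponse (ρ : 𝓑.Operators) (X Y : 𝓑.Family) (β τ : 𝓑.Strategy) : Prop :=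
  ∃ V, IsValueFamily ρ (stoppingPayoff X Y β) β V ∧
    (∀ᵐ ω ∂P, τ.1 ω < β.1 ω → V τ ω = (stoppingPayoff X Y β τ ω : EReal)) ∧
    ∀ σ, ∀ᵐ ω ∂P, assess ρ X Y β (𝓑.theta 0) σ ω ≤ assess ρ X Y β (𝓑.theta 0) τ ω

/-- Under `hα` the cap by `α` never cuts before the first contact `s` when the result is below `β`.
Hence `τ` and `s` agree wherever either precedes `β`, so `τ ∧ β = s ∧ β` and the assessments
coincide. -/
theorem IsBestResponseStep.isBestResponse [IsFiniteMeasure P] (hρ : IsEvaluation p ρ)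
    (h : IsPayoff p X Y) (hstep : IsBestResponseStep ρ X Y β α τ)
    (hα : ∀ V t, IsValueFamily ρ (stoppingPayoff X Y β) β V →
      IsEssInf P {g | ∃ σ : 𝓑.Strategy, IsContact V (stoppingPayoff X Y β) σ ∧ g = σ.1} t →
      ∀ᵐ ω ∂P, α.1 ω < β.1 ω → t ω ≤ α.1 ω) :
    IsBestResponse ρ X Y β τ := by
  have hX := h.admissible_X
  have hY := h.admissible_Y
  have hξ := isAdmissible_stoppingPayoff hX hY β
  obtain ⟨V, t, hV, ht, hτ⟩ := hstep
  obtain ⟨s, hs, hsinf⟩ := exists_contact_isEssInf hV hρ hX hY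
  have key : ∀ᵐ ω ∂P, (τ.1 ω < β.1 ω → τ.1 ω = s.1 ω) ∧ (s.1 ω < β.1 ω → s.1 ω = τ.1 ω) := by
    filter_upwards [hτ, ht.ae_eq hsinf, hα V t hV ht] with ω h1 h2 h3
    rw [h2] at h1 h3
    rw [h1]
    split_ifs with h4
    · have h5 : s.1 ω ≤ α.1 ω := by
        rcases lt_or_ge (α.1 ω) (β.1 ω) with h6 | h6
        · exact h3 h6
        · exact (((min_lt_iff.1 h4).resolve_right (not_lt.2 h6)).trans_le h6).le
      simp [min_eq_left h5]
    · rw [not_lt, le_min_iff] at h4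
      exact ⟨fun h5 => absurd h5 (not_lt.2 h4.2), fun h5 => absurd h5 (not_lt.2 h4.1)⟩
  refine ⟨V, hV, ?_, fun σ => ?_⟩
  · filter_upwards [key, hs, hV.congr hρ hX hY τ s, hξ.congr τ s] with ω h1 h2 h3 h4 hlt
    rw [h3 (h1.1 hlt), h2, h4 (h1.1 hlt)]
  · have hinf : ∀ᵐ ω ∂P, (s.inf β).1 ω = (τ.inf β).1 ω := by
      filter_upwards [key] with ω h1
      simp only [Strategy.inf_val]
      rcases lt_or_ge (s.1 ω) (β.1 ω) with h2 | h2
      · rw [h1.2 h2]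
      · rcases lt_or_ge (τ.1 ω) (β.1 ω) with h3 | h3
        · rw [h1.1 h3]
        · rw [min_eq_right h2, min_eq_right h3]
    filter_upwards [assess_le_firstContact hV hρ h hs hsinf σ,
      assess_eq_inf hρ hX hY β (𝓑.theta 0) s, assess_eq_inf hρ hX hY β (𝓑.theta 0) τ,
      hρ.congr_strategy hξ (Strategy.theta_zero_le _) hinf] with ω h1 h2 h3 h4
    rw [h3, ← h4, ← h2]
    exact h1

/-- After a best response against `β₀`, the opponent's update to `β` leaves the value at the best
response `α` unchanged where `α < β`. -/
theorem IsBestResponse.essInf_le [IsFiniteMeasure P] (hρ : IsEvaluation p ρ)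
    (hzo : ZeroOneLaw p ρ) (h : IsPayoff p X Y) {β₀ : 𝓑.Strategy}
    (hα : IsBestResponse ρ X Y β₀ α) (hβ : β.LE β₀)
    (heq : ∀ᵐ ω ∂P, α.1 ω < β.1 ω → β.1 ω = β₀.1 ω)
    (hV : IsValueFamily ρ (stoppingPayoff X Y β) β V) {t : Ω → Set.Icc (0 : ℝ) 𝓑.T}
    (ht : IsEssInf P
      {g | ∃ σ : 𝓑.Strategy, IsContact V (stoppingPayoff X Y β) σ ∧ g = σ.1} t) :
    ∀ᵐ ω ∂P, α.1 ω < β.1 ω → t ω ≤ α.1 ω := by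
  have hX := h.admissible_X
  have hY := h.admissible_Y
  obtain ⟨V₀, hV₀, hcontact, -⟩ := hα
  have hle : ∀ᵐ ω ∂P, ω ∈ {ω | α.1 ω < β.1 ω} → V α ω ≤ (stoppingPayoff X Y β α ω : EReal) := by
    refine hV.le_of_forall hρ hX hY fun σ hσ => ?_
    filter_upwards [assess_congr_opponent hρ hzo hX hY hβ hσ heq, hV₀.assess_le hσ, hcontact, heq]
      with ω h1 h2 h3 h4 (hω : α.1 ω < β.1 ω)
    have hω₀ : α.1 ω < β₀.1 ω := h4 hω ▸ hω
    rw [h3 hω₀, stoppingPayoff_of_lt hω₀] at h2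
    rw [h1 hω, stoppingPayoff_of_lt hω]
    exact h2
  refine essInf_contact_le hV hρ hX hY ht (α.measurableSet_lt_left β) ?_
  filter_upwards [hle, hV.payoff_le hρ hX hY α] with ω h1 h2 hω using le_antisymm (h1 hω) h2

theorem exists_isBestResponseStep [IsFiniteMeasure P] (hρ : IsEvaluation p ρ)
    (h : IsPayoff p X Y) (β α : 𝓑.Strategy) : ∃ τ, IsBestResponseStep ρ X Y β α τ := by
  have hX := h.admissible_X
  have hY := h.admissible_Y
  obtain ⟨V, hV⟩ := exists_isValueFamily hρ hX hY β
  obtain ⟨s, -, hs⟩ := exists_contact_isEssInf hV hρ hX hY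
  have hA := (s.inf α).measurableSet_lt_left β
  have hAα := Strategy.sigma_mono (s.inf_le_right α) _ hA
  refine ⟨Strategy.paste _ (s.inf α) α hA hAα, V, s.1, hV, hs, ae_of_all _ fun ω => ?_⟩
  split_ifs with hω
  · exact Strategy.paste_of_mem hA hAα hω
  · exact Strategy.paste_of_notMem hA hAα hω

end BestResponse

/-! ### Order combinatorics of the alternating updates -/

section Alternation

variable {α : Type*} [LinearOrder α]

/-- One update in the alternating scheme: from `a`, against `b`. -/
def Update (b a a' : α) : Prop := ∃ t, a' = if min t a < b then min t a else a

theorem Update.le {b a a' : α} (h : Update b a a') : a' ≤ a := by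
  obtain ⟨t, rfl⟩ := h
  split_ifs
  · exact min_le_right _ _
  · exact le_rfl

theorem Update.eq_of_le {b a a' : α} (h : Update b a a') (h' : b ≤ a') : a' = a := by
  obtain ⟨t, rfl⟩ := h
  split_ifs at h' ⊢ with h1
  · exact absurd h1 (not_lt.2 h')
  · rfl

/-- An update that ends at or above the opponent's value is no move, so a tie was already present
one step earlier; descending, it goes back to `u 0 = top`. -/
theorem Update.eq_top_of_eq {u : ℕ → α} {top : α} (h0 : u 0 = top)
    (h : ∀ m, Update (u (m + 1)) (u m) (u (m + 2))) (m : ℕ) (hm : u (m + 1) = u m) :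
    u m = top := by
  induction m with
  | zero => exact h0
  | succ m ih =>
    have h2 := (h m).eq_of_le hm.ge
    rw [h2] at hm
    exact hm ▸ ih hm.symm

/-- In the alternating scheme the earlier of the two current values determines who attains it. -/
theorem Update.not_clash {a b : ℕ → α} (hb : ∀ n, Update (a n) (b n) (b (n + 1)))
    (ha : ∀ n, Update (b (n + 1)) (a n) (a (n + 1))) {i j : ℕ} (hi : a i < b i) (hj : b j < a j)
    (h : a i = b j) : False := by
  rcases le_total i j with hij | hij
  -- From round `i` on, either `a` keeps its value and its lead, or the minimum has dropped strictly
  -- below `a i`; it never rises again.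
  · have key : (a j = a i ∧ a j < b j) ∨ min (a j) (b j) < a i := by
      clear hj h
      induction j, hij using Nat.le_induction with
      | base => exact Or.inl ⟨rfl, hi⟩
      | succ n _ ih =>
        rcases ih with ⟨h1, h2⟩ | h1
        · rcases lt_or_ge (b (n + 1)) (a n) with h3 | h3
          · exact Or.inr (min_lt_iff.2 (Or.inr (h1 ▸ h3)))
          · rcases (ha n).le.lt_or_eq with h4 | h4
            · exact Or.inr (min_lt_iff.2 (Or.inl (h1 ▸ h4)))
            · exact Or.inl ⟨h4.trans h1, by rw [h4, (hb n).eq_of_le h3]; exact h2⟩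
        · exact Or.inr ((min_le_min (ha n).le (hb n).le).trans_lt h1)
    rcases key with h1 | h1
    · exact lt_asymm h1.2 hj
    · rw [min_eq_right hj.le, h] at h1
      exact lt_irrefl _ h1
  · have key : (b i = b j ∧ b i < a i) ∨ min (a i) (b i) < b j := by
      clear hi h
      induction i, hij using Nat.le_induction with
      | base => exact Or.inl ⟨rfl, hj⟩
      | succ n _ ih =>
        rcases ih with ⟨h1, h2⟩ | h1
        · rcases (hb n).le.lt_or_eq with h3 | h3
          · exact Or.inr (min_lt_iff.2 (Or.inr (h1 ▸ h3)))
          · rcases lt_or_ge (a (n + 1)) (b (n + 1)) with h4 | h4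
            · exact Or.inr (min_lt_iff.2 (Or.inl (h4.trans_eq (h3.trans h1))))
            · exact Or.inl ⟨h3.trans h1, by rw [(ha n).eq_of_le h4, h3]; exact h2⟩
        · exact Or.inr ((min_le_min (ha n).le (hb n).le).trans_lt h1)
    rcases key with h1 | h1
    · exact lt_asymm h1.2 hi
    · rw [min_eq_left hi.le, h] at h1
      exact lt_irrefl _ h1

end Alternation

/-! ### Passage to the limit and the two tie-breaking rules -/

section Limit

variable {Ω : Type*} [mΩ : MeasurableSpace Ω] {P : Measure Ω} {𝓑 : BermudanFramework P}
  {p : ℝ≥0∞} {ρ : 𝓑.Operators} {X Y φ : 𝓑.Family} {β σ τ a' b' : 𝓑.Strategy}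
  {a b : ℕ → 𝓑.Strategy}

theorem ae_tendsto_of_eventually_eq
    (h : ∀ᵐ ω ∂P, ∃ N, ∀ n, N ≤ n → (a n).1 ω = a'.1 ω) :
    ∀ᵐ ω ∂P, Tendsto (fun n => (a n).1 ω) atTop (𝓝 (a'.1 ω)) :=
  h.mono fun _ ⟨N, hN⟩ => tendsto_const_nhds.congr' (eventually_atTop.2
    ⟨N, fun n hn => (hN n hn).symm⟩)

theorem stoppingPayoff_congr₂ (hX : IsAdmissible p X) (hY : IsAdmissible p Y)
    (β β' σ σ' : 𝓑.Strategy) : ∀ᵐ ω ∂P, β.1 ω = β'.1 ω → σ.1 ω = σ'.1 ω →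
      stoppingPayoff X Y β σ ω = stoppingPayoff X Y β' σ' ω := by
  filter_upwards [hX.congr σ σ', hY.congr β β'] with ω h1 h2 h3 h4
  simp only [stoppingPayoff, h3, h4, h1 h4, h2 h3]

theorem IsPayoff.eq_of_horizon (h : IsPayoff p X Y) (σ β : 𝓑.Strategy) :
    ∀ᵐ ω ∂P, σ.1 ω = 𝓑.horizon → β.1 ω = 𝓑.horizon → X σ ω = Y β ω := by
  filter_upwards [h.terminal_eq, h.admissible_X.congr σ 𝓑.terminal,
    h.admissible_Y.congr β 𝓑.terminal] with ω h1 h2 h3 h4 h5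
  rw [h2 h4, h3 h5, h1]

/-- Right-continuity along pairs of strategies, when the pay-offs are the values of one admissible
family. -/
theorem limsup_assess_eq (hρ : IsEvaluation p ρ) (hrc : RightContinuity p ρ)
    (hX : IsAdmissible p X) (hY : IsAdmissible p Y) (hφ : IsAdmissible p φ)
    (ha : ∀ᵐ ω ∂P, Antitone fun n => (a n).1 ω) (hb : ∀ᵐ ω ∂P, Antitone fun n => (b n).1 ω)
    (ha' : ∀ᵐ ω ∂P, ∃ N, ∀ n, N ≤ n → (a n).1 ω = a'.1 ω)
    (hb' : ∀ᵐ ω ∂P, ∃ N, ∀ n, N ≤ n → (b n).1 ω = b'.1 ω)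
    (h : ∀ n, ∀ᵐ ω ∂P, stoppingPayoff X Y (b n) (a n) ω = φ ((a n).inf (b n)) ω) :
    ∀ᵐ ω ∂P, limsup (fun n => (assess ρ X Y (b n) (𝓑.theta 0) (a n) ω : EReal)) atTop =
      (assess ρ X Y b' (𝓑.theta 0) a' ω : EReal) := by
  have hinf : ∀ᵐ ω ∂P, ∃ N, ∀ n, N ≤ n → ((a n).inf (b n)).1 ω = (a'.inf b').1 ω := by
    filter_upwards [ha', hb'] with ω ⟨N, hN⟩ ⟨M, hM⟩
    exact ⟨max N M, fun n hn => by
      simp [hN n ((le_max_left _ _).trans hn), hM n ((le_max_right _ _).trans hn)]⟩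
  have hlim : ∀ᵐ ω ∂P, stoppingPayoff X Y b' a' ω = φ (a'.inf b') ω := by
    filter_upwards [ha', hb', ae_all_iff.2 h,
      ae_all_iff.2 fun n => stoppingPayoff_congr₂ hX hY b' (b n) a' (a n),
      ae_all_iff.2 fun n => hφ.congr ((a n).inf (b n)) (a'.inf b')]
      with ω ⟨N, hN⟩ ⟨M, hM⟩ h1 h2 h3
    have hN' := hN (max N M) (le_max_left _ _)
    have hM' := hM (max N M) (le_max_right _ _)
    rw [h2 _ hM'.symm hN'.symm, h1, h3 _ (by simp [hN', hM'])]
  have hanti : ∀ᵐ ω ∂P, Antitone fun n => ((a n).inf (b n)).1 ω := by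
    filter_upwards [ha, hb] with ω h1 h2 i j hij using min_le_min (h1 hij) (h2 hij)
  filter_upwards [hrc φ hφ _ _ hanti (ae_tendsto_of_eventually_eq hinf),
    ae_all_iff.2 fun n => hρ.congr_ae (𝓑.theta 0) (inLp_stoppingPayoff_inf hX hY (b n) (a n)) (h n),
    hρ.congr_ae (𝓑.theta 0) (inLp_stoppingPayoff_inf hX hY b' a') hlim] with ω h1 h2 h3
  simp only [assess]
  rw [h3, ← h1]
  simp only [h2]

/-- Optimality against `b n` passes to the limit. -/
theorem assess_le_of_limit (hρ : IsEvaluation p ρ) (hrc : RightContinuity p ρ) (h : IsPayoff p X Y)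
    (ha : ∀ᵐ ω ∂P, Antitone fun n => (a n).1 ω) (hb : ∀ᵐ ω ∂P, Antitone fun n => (b n).1 ω)
    (ha' : ∀ᵐ ω ∂P, ∃ N, ∀ n, N ≤ n → (a n).1 ω = a'.1 ω)
    (hb' : ∀ᵐ ω ∂P, ∃ N, ∀ n, N ≤ n → (b n).1 ω = b'.1 ω)
    (htie : ∀ᵐ ω ∂P, ∀ n, (a n).1 ω = (b n).1 ω → (a n).1 ω = 𝓑.horizon)
    (hclash : ∀ᵐ ω ∂P, ∀ i j, (a i).1 ω < (b i).1 ω → (b j).1 ω < (a j).1 ω →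
      (a i).1 ω ≠ (b j).1 ω)
    (hopt : ∀ n, ∀ σ, ∀ᵐ ω ∂P, assess ρ X Y (b n) (𝓑.theta 0) σ ω ≤
      assess ρ X Y (b n) (𝓑.theta 0) (a n) ω) (σ : 𝓑.Strategy) :
    ∀ᵐ ω ∂P, assess ρ X Y b' (𝓑.theta 0) σ ω ≤ assess ρ X Y b' (𝓑.theta 0) a' ω := by
  classical
  have hX := h.admissible_X
  have hY := h.admissible_Y
  have hA := σ.measurableSet_lt_left b'
  have hAT := Strategy.sigma_mono σ.le_terminal _ hA
  -- Where `σ` does not precede `b'` it is irrelevant against `b'`, so it may be moved to `T`. As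
  -- `b' ≤ b n`, the new deviation then ties with `b n` only at `T`.
  let σ' := Strategy.paste _ σ 𝓑.terminal hA hAT
  have hσ' : ∀ ω, (σ.1 ω < b'.1 ω ∧ σ'.1 ω = σ.1 ω) ∨
      (b'.1 ω ≤ σ.1 ω ∧ σ'.1 ω = 𝓑.horizon) := by
    intro ω
    by_cases hω : σ.1 ω < b'.1 ω
    · exact Or.inl ⟨hω, Strategy.paste_of_mem hA hAT hω⟩
    · exact Or.inr ⟨not_lt.1 hω, Strategy.paste_of_notMem hA hAT hω⟩
  have hdev : ∀ᵐ ω ∂P, assess ρ X Y b' (𝓑.theta 0) σ ω = assess ρ X Y b' (𝓑.theta 0) σ' ω := by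
    filter_upwards [assess_eq_inf hρ hX hY b' (𝓑.theta 0) σ,
      assess_eq_inf hρ hX hY b' (𝓑.theta 0) σ',
      hρ.congr_strategy (isAdmissible_stoppingPayoff hX hY b')
        (Strategy.theta_zero_le (σ.inf b')) (σ' := σ'.inf b') (ae_of_all _ fun ω => by
          rcases hσ' ω with ⟨-, h2⟩ | ⟨h1, h2⟩
          · simp [h2]
          · simp [h1, h2, le_horizon])] with ω h1 h2 h3
    rw [h1, h2, h3]
  -- the pay-offs of the deviation
  let φ : 𝓑.Family := fun ν ω => if ν.1 ω < σ'.1 ω then Y ν ω else X ν ω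
  have hφ : IsAdmissible p φ :=
    IsAdmissible.ite hY hX (A := fun ν => {ω | ν.1 ω < σ'.1 ω})
      (fun ν => ν.measurableSet_lt_left σ') (fun ν ν' ω heq => by simp [heq])
      (fun ν ω hω => if_pos hω) (fun ν ω hω => if_neg hω)
  have hφpay : ∀ n, ∀ᵐ ω ∂P, stoppingPayoff X Y (b n) σ' ω = φ (σ'.inf (b n)) ω := by
    intro n
    filter_upwards [hb, hb', hX.congr σ' (σ'.inf (b n)), hY.congr (b n) (σ'.inf (b n)),
      h.eq_of_horizon (σ'.inf (b n)) (b n)] with ω h1 ⟨N, hN⟩ h3 h4 h5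
    have hble : b'.1 ω ≤ (b n).1 ω :=
      hN (max N n) (le_max_left _ _) ▸ h1 (le_max_right N n)
    rcases lt_trichotomy (σ'.1 ω) ((b n).1 ω) with hlt | heq | hgt
    · rw [stoppingPayoff_of_lt hlt, h3 (by simp [hlt.le])]
      simp [φ, hlt.le]
    · have hT : σ'.1 ω = 𝓑.horizon := by
        rcases hσ' ω with ⟨h6, h7⟩ | ⟨-, h7⟩
        · exact absurd (h7.symm.trans heq) (h6.trans_le hble).ne
        · exact h7
      rw [stoppingPayoff_of_le heq.ge, ← h5 (by simp [← heq, hT]) (heq ▸ hT)]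
      simp [φ, heq]
    · rw [stoppingPayoff_of_le hgt.le, h4 (by simp [hgt.le])]
      simp [φ, hgt]
  -- the pay-offs of the best responses
  let A : 𝓑.Strategy → Set Ω := fun ν =>
    ⋃ j, {ω | ν.1 ω = (b j).1 ω} ∩ {ω | ν.1 ω < (a j).1 ω}
  let ψ : 𝓑.Family := fun ν ω => if ω ∈ A ν then Y ν ω else X ν ω
  have hψ : IsAdmissible p ψ :=
    IsAdmissible.ite hY hX (A := A)
      (fun ν => MeasurableSet.iUnion fun j =>
        MeasurableSet.inter (ν.measurableSet_eq (b j)) (ν.measurableSet_lt_left (a j)))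
      (fun ν ν' ω heq => by simp [A, heq])
      (fun ν ω hω => if_pos hω) (fun ν ω hω => if_neg hω)
  -- `A ν` records that the opponent stops strictly first at `ν` in some round. If `a n` leads in
  -- round `n`, `hclash` excludes its value from `A`; ties lie at `T`, where `X` and `Y` agree.
  have hψpay : ∀ n, ∀ᵐ ω ∂P, stoppingPayoff X Y (b n) (a n) ω = ψ ((a n).inf (b n)) ω := by
    intro n
    filter_upwards [htie, hclash, hX.congr (a n) ((a n).inf (b n)),
      hY.congr (b n) ((a n).inf (b n)), h.eq_of_horizon ((a n).inf (b n)) (b n)]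
      with ω h1 h2 h3 h4 h5
    rcases lt_trichotomy ((a n).1 ω) ((b n).1 ω) with hlt | heq | hgt
    · have hmin : ((a n).inf (b n)).1 ω = (a n).1 ω := by simp [hlt.le]
      have hmem : ω ∉ A ((a n).inf (b n)) := by
        intro hmem
        obtain ⟨j, hj1, hj2⟩ := Set.mem_iUnion.1 hmem
        rw [Set.mem_ofPred_eq, hmin] at hj1 hj2
        exact h2 n j hlt (hj1 ▸ hj2) hj1
      rw [stoppingPayoff_of_lt hlt, h3 hmin.symm]
      simp only [ψ, if_neg hmem]
    · have hT := h1 n heq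
      have hmin : ((a n).inf (b n)).1 ω = 𝓑.horizon := by simp [← heq, hT]
      have hmem : ω ∉ A ((a n).inf (b n)) := by
        intro hmem
        obtain ⟨j, hj1, hj2⟩ := Set.mem_iUnion.1 hmem
        rw [Set.mem_ofPred_eq, hmin] at hj2
        exact absurd hj2 (not_lt.2 (le_horizon _))
      rw [stoppingPayoff_of_le heq.ge, ← h5 hmin (heq ▸ hT)]
      simp only [ψ, if_neg hmem]
    · have hmin : ((a n).inf (b n)).1 ω = (b n).1 ω := by simp [hgt.le]
      have hmem : ω ∈ A ((a n).inf (b n)) :=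
        Set.mem_iUnion.2 ⟨n, hmin, hmin.trans_lt hgt⟩
      rw [stoppingPayoff_of_le hgt.le, h4 hmin.symm]
      simp only [ψ, if_pos hmem]
  filter_upwards [hdev, limsup_assess_eq (a := fun _ => σ') hρ hrc hX hY hφ
      (ae_of_all _ fun _ => antitone_const) hb (ae_of_all _ fun _ => ⟨0, fun _ _ => rfl⟩) hb' hφpay,
    limsup_assess_eq hρ hrc hX hY hψ ha hb ha' hb' hψpay,
    ae_all_iff.2 fun n => hopt n σ'] with ω h1 h2 h3 h4
  rw [h1, ← EReal.coe_le_coe_iff, ← h2, ← h3]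
  exact limsup_le_limsup (Eventually.of_forall fun n => EReal.coe_le_coe_iff.2 (h4 n))

theorem J₂_eq_assess (ρ : 𝓑.Operators) (X Y : 𝓑.Family) (τ₁ τ₂ : 𝓑.Strategy) :
    J₂ ρ X Y τ₁ τ₂ = assess ρ X Y τ₁ (𝓑.theta 0) τ₂ := by
  rw [J₂, Strategy.inf_comm]
  rfl

/-- Exchanging both the agents and the two pay-offs reverses the tie rule; integrability is
inherited this way. -/
theorem payoff₁_eq_stoppingPayoff (X Y : 𝓑.Family) (τ₁ τ₂ : 𝓑.Strategy) :
    payoff₁ X Y τ₁ τ₂ = stoppingPayoff Y X τ₁ τ₂ := by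
  funext ω
  rcases le_or_gt (τ₁.1 ω) (τ₂.1 ω) with h | h
  · rw [stoppingPayoff_of_le h]; exact if_pos h
  · rw [stoppingPayoff_of_lt h]; exact if_neg (not_le.2 h)

theorem inLp_payoff₁ (hX : IsAdmissible p X) (hY : IsAdmissible p Y) (τ₁ τ₂ : 𝓑.Strategy) :
    (τ₁.inf τ₂).InLp p (payoff₁ X Y τ₁ τ₂) := by
  rw [payoff₁_eq_stoppingPayoff, Strategy.inf_comm]
  exact inLp_stoppingPayoff_inf hY hX τ₁ τ₂

/-- The two pay-offs differ only at ties, where `J₁` pays `X` and `assess` pays `Y ≥ X`. So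
optimality for `assess` bounds every deviation in `J₁`. -/
theorem J₁_le_assess (hρ : IsEvaluation p ρ) (h : IsPayoff p X Y) (τ₁ τ₂ : 𝓑.Strategy) :
    ∀ᵐ ω ∂P, J₁ ρ X Y τ₁ τ₂ ω ≤ assess ρ X Y τ₂ (𝓑.theta 0) τ₁ ω := by
  refine hρ.monotonicity _ _ _ _ (inLp_payoff₁ h.admissible_X h.admissible_Y τ₁ τ₂)
    (inLp_stoppingPayoff_inf h.admissible_X h.admissible_Y τ₂ τ₁) ?_
  filter_upwards [h.le τ₁, h.admissible_Y.congr τ₁ τ₂] with ω h1 h2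
  rcases lt_trichotomy (τ₁.1 ω) (τ₂.1 ω) with h3 | h3 | h3
  · simp [payoff₁, stoppingPayoff, h3, h3.le]
  · simpa [payoff₁, stoppingPayoff, h3, ← h2 h3] using h1
  · simp [payoff₁, stoppingPayoff, h3.not_ge, h3.not_gt]

theorem J₁_eq_assess (hρ : IsEvaluation p ρ) (h : IsPayoff p X Y) {τ₁ τ₂ : 𝓑.Strategy}
    (htie : ∀ᵐ ω ∂P, τ₁.1 ω = τ₂.1 ω → τ₁.1 ω = 𝓑.horizon) :
    ∀ᵐ ω ∂P, J₁ ρ X Y τ₁ τ₂ ω = assess ρ X Y τ₂ (𝓑.theta 0) τ₁ ω := by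
  refine hρ.congr_ae _ (inLp_payoff₁ h.admissible_X h.admissible_Y τ₁ τ₂) ?_
  filter_upwards [htie, h.eq_of_horizon τ₁ τ₂] with ω h1 h2
  rcases lt_trichotomy (τ₁.1 ω) (τ₂.1 ω) with h3 | h3 | h3
  · simp [payoff₁, stoppingPayoff, h3, h3.le]
  · simpa [payoff₁, stoppingPayoff, h3] using h2 (h1 h3) (h3 ▸ h1 h3)
  · simp [payoff₁, stoppingPayoff, h3.not_ge, h3.not_gt]

end Limit

/-! ### The recursion and the equilibrium -/

section Sequence

variable {Ω : Type*} [mΩ : MeasurableSpace Ω] {P : Measure Ω} {𝓑 : BermudanFramework P}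
  {p : ℝ≥0∞} {ρ ρ₁ ρ₂ : 𝓑.Operators} {X Y X₁ Y₁ X₂ Y₂ : 𝓑.Family} {β α τ' : 𝓑.Strategy}
  {τ : ℕ → 𝓑.Strategy}

theorem IsBestResponseStep.update (h : IsBestResponseStep ρ X Y β α τ') :
    ∀ᵐ ω ∂P, Update (β.1 ω) (α.1 ω) (τ'.1 ω) := by
  obtain ⟨_, t, -, -, h⟩ := h
  exact h.mono fun ω hω => ⟨t ω, hω⟩

theorem IsBestResponseSequence.update
    (h : IsBestResponseSequence ρ₁ ρ₂ X₁ Y₁ X₂ Y₂ τ) :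
    ∀ᵐ ω ∂P, ∀ m, Update ((τ (m + 2)).1 ω) ((τ (m + 1)).1 ω) ((τ (m + 3)).1 ω) := by
  refine ae_all_iff.2 fun m => ?_
  obtain ⟨n, rfl | rfl⟩ := Nat.even_or_odd' m
  · exact (h.2.2 n).1.update
  · exact (h.2.2 n).2.update

/-- Induction along the recursion. The first caps are `T`, where the condition on the cap is
trivial; afterwards it follows from the agent's previous best response, since an opponent who does
not end up before it has not moved. -/
theorem IsBestResponseSequence.isBestResponse [IsFiniteMeasure P]
    (hρ₁ : IsEvaluation p ρ₁) (hρ₂ : IsEvaluation p ρ₂)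
    (hzo₁ : ZeroOneLaw p ρ₁) (hzo₂ : ZeroOneLaw p ρ₂)
    (h₁ : IsPayoff p X₁ Y₁) (h₂ : IsPayoff p X₂ Y₂)
    (h : IsBestResponseSequence ρ₁ ρ₂ X₁ Y₁ X₂ Y₂ τ) (n : ℕ) :
    IsBestResponse ρ₁ X₁ Y₁ (τ (2 * n + 2)) (τ (2 * n + 3)) ∧
      IsBestResponse ρ₂ X₂ Y₂ (τ (2 * n + 3)) (τ (2 * n + 4)) := by
  have hle : ∀ m, (τ (m + 3)).LE (τ (m + 1)) := fun m =>
    h.update.mono fun ω hω => (hω m).le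
  have heq : ∀ m, ∀ᵐ ω ∂P, (τ (m + 2)).1 ω < (τ (m + 3)).1 ω →
      (τ (m + 3)).1 ω = (τ (m + 1)).1 ω := fun m =>
    h.update.mono fun ω hω hlt => (hω m).eq_of_le hlt.le
  induction n with
  | zero =>
    refine ⟨(h.2.2 0).1.isBestResponse hρ₁ h₁ fun V t _ _ => ?_,
      (h.2.2 0).2.isBestResponse hρ₂ h₂ fun V t _ _ => ?_⟩
    · exact h.1.mono fun ω hω _ => hω.symm ▸ le_horizon _
    · exact h.2.1.mono fun ω hω _ => hω.symm ▸ le_horizon _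
  | succ n ih =>
    exact ⟨(h.2.2 (n + 1)).1.isBestResponse hρ₁ h₁ fun V t hV ht =>
        ih.1.essInf_le hρ₁ hzo₁ h₁ (hle (2 * n + 1)) (heq (2 * n + 1)) hV ht,
      (h.2.2 (n + 1)).2.isBestResponse hρ₂ h₂ fun V t hV ht =>
        ih.2.essInf_le hρ₂ hzo₂ h₂ (hle (2 * n + 2)) (heq (2 * n + 2)) hV ht⟩

theorem exists_isBestResponseSequence [IsFiniteMeasure P]
    (hρ₁ : IsEvaluation p ρ₁) (hρ₂ : IsEvaluation p ρ₂)
    (h₁ : IsPayoff p X₁ Y₁) (h₂ : IsPayoff p X₂ Y₂) :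
    ∃ τ : ℕ → 𝓑.Strategy, IsBestResponseSequence ρ₁ ρ₂ X₁ Y₁ X₂ Y₂ τ := by
  choose f₁ hf₁ using exists_isBestResponseStep hρ₁ h₁
  choose f₂ hf₂ using exists_isBestResponseStep hρ₂ h₂
  let s : ℕ → 𝓑.Strategy × 𝓑.Strategy := fun n =>
    Nat.rec (𝓑.terminal, 𝓑.terminal)
      (fun _ q => (f₁ q.2 q.1, f₂ (f₁ q.2 q.1) q.2)) n
  -- Odd indices list agent 1, even ones agent 2; truncated subtraction makes `τ 0` a harmless copy
  -- of `τ 2`.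
  let τ : ℕ → 𝓑.Strategy := fun m => if m % 2 = 1 then (s (m / 2)).1 else (s (m / 2 - 1)).2
  have hodd : ∀ n, τ (2 * n + 1) = (s n).1 := fun n => by
    have h1 : (2 * n + 1) % 2 = 1 := by omega
    have h2 : (2 * n + 1) / 2 = n := by omega
    simp only [τ, h1, h2, if_true]
  have heven : ∀ n, τ (2 * n + 2) = (s n).2 := fun n => by
    have h1 : (2 * n + 2) % 2 ≠ 1 := by omega
    have h2 : (2 * n + 2) / 2 - 1 = n := by omega
    simp only [τ, if_neg h1, h2]
  refine ⟨τ, ?_, ?_, fun n => ?_⟩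
  · rw [hodd 0]; exact ae_of_all _ fun _ => rfl
  · rw [heven 0]; exact ae_of_all _ fun _ => rfl
  · have h3 : τ (2 * n + 3) = (s (n + 1)).1 := hodd (n + 1)
    have h4 : τ (2 * n + 4) = (s (n + 1)).2 := heven (n + 1)
    rw [hodd, heven, h3, h4]
    exact ⟨hf₁ _ _, hf₂ _ _⟩

theorem IsBestResponseSequence.exists_limit_isNash [IsFiniteMeasure P]
    (hρ₁ : IsEvaluation p ρ₁) (hρ₂ : IsEvaluation p ρ₂)
    (hzo₁ : ZeroOneLaw p ρ₁) (hzo₂ : ZeroOneLaw p ρ₂)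
    (hrc₁ : RightContinuity p ρ₁) (hrc₂ : RightContinuity p ρ₂)
    (h₁ : IsPayoff p X₁ Y₁) (h₂ : IsPayoff p X₂ Y₂)
    (h : IsBestResponseSequence ρ₁ ρ₂ X₁ Y₁ X₂ Y₂ τ) :
    ∃ τ₁ τ₂ : 𝓑.Strategy,
      (∀ᵐ ω ∂P, Tendsto (fun n => (τ (2 * n + 1)).1 ω) atTop (𝓝 (τ₁.1 ω))) ∧
      (∀ᵐ ω ∂P, Tendsto (fun n => (τ (2 * n)).1 ω) atTop (𝓝 (τ₂.1 ω))) ∧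
      IsNash ρ₁ ρ₂ X₁ Y₁ X₂ Y₂ τ₁ τ₂ := by
  have hbest := h.isBestResponse hρ₁ hρ₂ hzo₁ hzo₂ h₁ h₂
  have hup := h.update
  have hanti : ∀ k, ∀ᵐ ω ∂P, Antitone fun n => (τ (2 * n + (k + 1))).1 ω := fun k =>
    hup.mono fun ω hω => antitone_nat_of_succ_le fun n => by
      have := (hω (2 * n + k)).le
      rwa [show 2 * (n + 1) + (k + 1) = 2 * n + k + 3 by ring]
  have htie : ∀ᵐ ω ∂P, ∀ m, (τ (m + 2)).1 ω = (τ (m + 1)).1 ω → (τ (m + 1)).1 ω = 𝓑.horizon := by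
    filter_upwards [hup, h.1] with ω h3 h4 m hm
    exact Update.eq_top_of_eq (u := fun m => (τ (m + 1)).1 ω) h4 h3 m hm
  obtain ⟨τ₁, hτ₁⟩ := Strategy.exists_limit (hanti 0)
  obtain ⟨τ₂, hτ₂⟩ := Strategy.exists_limit (hanti 1)
  have hτ₁' : ∀ᵐ ω ∂P, ∃ N, ∀ n, N ≤ n → (τ (2 * n + 3)).1 ω = τ₁.1 ω :=
    hτ₁.mono fun ω ⟨N, hN⟩ => ⟨N, fun n hn => hN (n + 1) (hn.trans n.le_succ)⟩
  have hτ₂' : ∀ᵐ ω ∂P, ∃ N, ∀ n, N ≤ n → (τ (2 * n + 4)).1 ω = τ₂.1 ω :=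
    hτ₂.mono fun ω ⟨N, hN⟩ => ⟨N, fun n hn => hN (n + 1) (hn.trans n.le_succ)⟩
  have htie' : ∀ᵐ ω ∂P, τ₁.1 ω = τ₂.1 ω → τ₁.1 ω = 𝓑.horizon := by
    filter_upwards [htie, hτ₁', hτ₂] with ω h3 ⟨N, hN⟩ ⟨M, hM⟩ heq
    have hN' := hN (max N M) (le_max_left _ _)
    have hM' := hM (max N M) (le_max_right _ _)
    rw [heq, ← hM']
    exact h3 (2 * max N M + 1) (hN'.trans (heq.trans hM'.symm))
  have hlim₂ : ∀ᵐ ω ∂P, Tendsto (fun n => (τ (2 * n)).1 ω) atTop (𝓝 (τ₂.1 ω)) :=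
    -- The shift by one discards `τ 0`, which the recursion leaves arbitrary.
    (ae_tendsto_of_eventually_eq (a := fun n => τ (2 * n + 2)) hτ₂).mono fun ω hω =>
      (tendsto_add_atTop_iff_nat (f := fun n => (τ (2 * n)).1 ω) 1).1 hω
  have hopt₁ : ∀ σ, ∀ᵐ ω ∂P, assess ρ₁ X₁ Y₁ τ₂ (𝓑.theta 0) σ ω ≤
      assess ρ₁ X₁ Y₁ τ₂ (𝓑.theta 0) τ₁ ω := by
    -- Each response is paired with the strategy it answers, its immediate predecessor; best
    -- responses start at `τ 3`.
    refine assess_le_of_limit (a := fun n => τ (2 * n + 3)) (b := fun n => τ (2 * n + 2))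
      hρ₁ hrc₁ h₁ (hanti 2) (hanti 1) hτ₁' hτ₂ ?_ ?_ (fun n => (hbest n).1.choose_spec.2.2)
    · exact htie.mono fun ω hω n hn => hn.trans (hω (2 * n + 1) hn)
    · exact hup.mono fun ω hω i j hi hj heq => Update.not_clash
        (a := fun n => (τ (2 * n + 3)).1 ω) (b := fun n => (τ (2 * n + 2)).1 ω)
        (fun n => hω (2 * n + 1)) (fun n => hω (2 * n + 2)) hi hj heq
  have hopt₂ : ∀ σ, ∀ᵐ ω ∂P, assess ρ₂ X₂ Y₂ τ₁ (𝓑.theta 0) σ ω ≤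
      assess ρ₂ X₂ Y₂ τ₁ (𝓑.theta 0) τ₂ ω := by
    refine assess_le_of_limit (a := fun n => τ (2 * n + 4)) (b := fun n => τ (2 * n + 3))
      hρ₂ hrc₂ h₂ (hanti 3) (hanti 2) hτ₂' hτ₁' ?_ ?_ (fun n => (hbest n).2.choose_spec.2.2)
    · exact htie.mono fun ω hω n hn => hn.trans (hω (2 * n + 2) hn)
    · exact hup.mono fun ω hω i j hi hj heq => Update.not_clash
        (a := fun n => (τ (2 * n + 4)).1 ω) (b := fun n => (τ (2 * n + 3)).1 ω)
        (fun n => hω (2 * n + 2)) (fun n => hω (2 * n + 3)) hi hj heq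
  refine ⟨τ₁, τ₂, ae_tendsto_of_eventually_eq hτ₁, hlim₂, fun σ => ?_, fun σ => ?_⟩
  · filter_upwards [J₁_le_assess hρ₁ h₁ σ τ₂, J₁_eq_assess hρ₁ h₁ htie', hopt₁ σ] with ω h3 h4 h5
    rw [h4]
    exact h3.trans h5
  · simp only [J₂_eq_assess]
    exact hopt₂ σ

end Sequence

end BermudanFramework

theorem theorem1 {Ω : Type*} [MeasurableSpace Ω] (P : Measure Ω) [IsProbabilityMeasure P]
    (𝓑 : BermudanFramework P) (p : ℝ≥0∞) (hp : 1 ≤ p)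
    (ρ₁ ρ₂ : 𝓑.Operators) (X₁ Y₁ X₂ Y₂ : 𝓑.Family)
    (hρ₁ : BermudanFramework.IsEvaluation p ρ₁) (hρ₂ : BermudanFramework.IsEvaluation p ρ₂)
    (hzo₁ : BermudanFramework.ZeroOneLaw p ρ₁) (hzo₂ : BermudanFramework.ZeroOneLaw p ρ₂)
    (hrc₁ : BermudanFramework.RightContinuity p ρ₁) (hrc₂ : BermudanFramework.RightContinuity p ρ₂)
    (h₁ : BermudanFramework.IsPayoff p X₁ Y₁) (h₂ : BermudanFramework.IsPayoff p X₂ Y₂) :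
    (∃ τ₁ τ₂ : 𝓑.Strategy, BermudanFramework.IsNash ρ₁ ρ₂ X₁ Y₁ X₂ Y₂ τ₁ τ₂) ∧
    (∃ τ : ℕ → 𝓑.Strategy,
      BermudanFramework.IsBestResponseSequence ρ₁ ρ₂ X₁ Y₁ X₂ Y₂ τ) ∧
    (∀ τ : ℕ → 𝓑.Strategy,
      BermudanFramework.IsBestResponseSequence ρ₁ ρ₂ X₁ Y₁ X₂ Y₂ τ →
      ∃ τ₁ τ₂ : 𝓑.Strategy,
        (∀ᵐ ω ∂P, Tendsto (fun n => (τ (2 * n + 1)).1 ω) atTop (𝓝 (τ₁.1 ω))) ∧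
        (∀ᵐ ω ∂P, Tendsto (fun n => (τ (2 * n)).1 ω) atTop (𝓝 (τ₂.1 ω))) ∧
        BermudanFramework.IsNash ρ₁ ρ₂ X₁ Y₁ X₂ Y₂ τ₁ τ₂) := by
  have hseq := BermudanFramework.exists_isBestResponseSequence hρ₁ hρ₂ h₁ h₂
  have hlim := fun τ (hτ : BermudanFramework.IsBestResponseSequence ρ₁ ρ₂ X₁ Y₁ X₂ Y₂ τ) =>
    hτ.exists_limit_isNash hρ₁ hρ₂ hzo₁ hzo₂ hrc₁ hrc₂ h₁ h₂
  refine ⟨?_, hseq, hlim⟩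
  obtain ⟨τ, hτ⟩ := hseq
  obtain ⟨τ₁, τ₂, -, -, hnash⟩ := hlim τ hτ
  exact ⟨τ₁, τ₂, hnash⟩
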